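/- **Linkages.** A linkage is a graph whose edges carry positive lengths. A *configuration* places its vertices (joints) in the Euclidean plane so that every edge becomes a closed segment (link) of its prescribed length, two distinct links with a common joint meet only in that joint, and any two other distinct links are disjoint. A *motion* is a continuous movement of the joints during which the placement is a configuration at all times. Two configurations are *equivalent* if a motion leads from one to the other. **The tree of $n$ petals.** It has the joints $O$ and $A_i,B_i,C_i$ ($0\le i<n$, indices mod $n$) and the links $OA_i$, $A_iB_i$, $B_iC_i$ with $\|OA_i\|=1$, $\|A_iB_i\|=l_1>0$, $\|B_iC_i\|=l_2>0$. The petal angle $\theta_i\in[0,2\pi)$ is the counterclockwise angle $\angle A_{i-1}OA_i$. Put $\bar\theta=2\pi/n$, $\beta=\arcsin l_1$, $\alpha=(2\pi-\beta)/(n-1)$, $l_P(\theta)=\cos\theta-\sqrt{l_1^2-\sin^2\theta}$, $\theta_m=\arccos\frac{1-l_1^2+l_2^2}{2l_2}$. The *constraints* on $(n,l_1,l_2)$ are $$n>4,\quad l_1<1,\quad \bar\theta<\beta,\quad l_2<l_P(\bar\theta),\quad l_2>\sin\beta\cos\beta,\quad l_1+l_2>1,\quad \alpha<\theta_m .$$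 **Restricted petals.** Write $A'=A_{i-1}$, $A=A_i$, $B=B_i$, $C=C_i$, and let $\mathcal C$ be the circle with centre $A$ and radius $l_1$. Petal $i$ is *restricted* if (i) $\theta_i<\beta$; (ii) $B$ lies on the open small arc $PQ$ of $\mathcal C$, where $P$ is the first point of $\mathcal C$ on the line $OA'$ directed from $O$ to $A'$, and $Q$ is the point of $\mathcal C$ on the segment $OA$; (iii) $C$ lies in the open region bounded by the quadrilateral $ORBS$, where $R\in OA'$ and $S\in OA$ are the feet of the perpendiculars from $B$ to $OA'$ and $OA$. **Theorem 5.** Let $(n,l_1,l_2)$ satisfy the constraints. Call a placement of the joints of the tree of $n$ petals a *start* if the links $OA_0,\dots,OA_{n-1}$ leave $O$ in this counterclockwise cyclic order (going around $O$ once), $\theta_i\in(\alpha,\beta)$ for all $i$, and every petal is restricted. 1. During any motion that begins in a start, all petal angles remain in $(\alpha,\beta)$. 2. Consequently no motion leads from a start to a configuration in which some petal angle is less than $\alpha$. 3. The tree can lock: its underlying graph is a tree, and it has a configuration that is a start and another configuration, with the links $OA_i$ in the same counterclockwise cyclic order, in which some petal angle is less than $\alpha$ (by 2 these two are not equivalent).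 Parameters $(n,l_1,l_2)$ that satisfy all the constraints exist. -/

import Mathlib

open Real Set

namespace PetalTree

noncomputable section

/-! The Euclidean plane is `ℂ`. -/

/-- A graph whose edges are labelled with positive lengths.  The value `length u v` matters only
when `u` and `v` are adjacent. -/
structure Linkage (V : Type*) where
  graph : SimpleGraph V
  length : V → V → ℝ
  length_symm : ∀ u v, length u v = length v u
  length_pos : ∀ u v, graph.Adj u v → 0 < length u v

namespace Linkage

variable {V : Type*}

/-- A (simple) configuration: every link has its prescribed length, two distinct links with a
common joint meet only at that joint, and any two other distinct links are disjoint. -/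
structure IsConfiguration (L : Linkage V) (p : V → ℂ) : Prop where
  dist_eq : ∀ u v, L.graph.Adj u v → dist (p u) (p v) = L.length u v
  inter_eq : ∀ u v w, L.graph.Adj u v → L.graph.Adj u w → v ≠ w →
    segment ℝ (p u) (p v) ∩ segment ℝ (p u) (p w) = {p u}
  disjoint : ∀ u v w x, L.graph.Adj u v → L.graph.Adj w x →
    u ≠ w → u ≠ x → v ≠ w → v ≠ x →
    Disjoint (segment ℝ (p u) (p v)) (segment ℝ (p w) (p x))

/-- A motion: a continuous movement of all joints through configurations, over the time
interval `[0, 1]`. -/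
structure IsMotion (L : Linkage V) (γ : unitInterval → V → ℂ) : Prop where
  continuous : Continuous γ
  isConfiguration : ∀ t, L.IsConfiguration (γ t)

/-- Two placements are equivalent if some motion leads from the first to the second. -/
def Equivalent (L : Linkage V) (p q : V → ℂ) : Prop :=
  ∃ γ : unitInterval → V → ℂ, L.IsMotion γ ∧ γ 0 = p ∧ γ 1 = q

end Linkage

/-- The joints of the tree of `n` petals. -/
inductive Joint (n : ℕ) : Type
  | O : Joint n
  | A (i : Fin n) : Joint n
  | B (i : Fin n) : Joint n
  | C (i : Fin n) : Joint n

/-- The links of the tree of `n` petals, directed away from `O`. -/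
inductive IsLink {n : ℕ} : Joint n → Joint n → Prop
  | OA (i : Fin n) : IsLink Joint.O (Joint.A i)
  | AB (i : Fin n) : IsLink (Joint.A i) (Joint.B i)
  | BC (i : Fin n) : IsLink (Joint.B i) (Joint.C i)

/-- The link lengths `‖O A_i‖ = 1`, `‖A_i B_i‖ = l₁`, `‖B_i C_i‖ = l₂`
(with `0` for pairs of joints that are not joined by a link). -/
def linkLength {n : ℕ} (l₁ l₂ : ℝ) : Joint n → Joint n → ℝ
  | .O, .A _ => 1
  | .A _, .O => 1
  | .A i, .B j => if i = j then l₁ else 0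
  | .B j, .A i => if i = j then l₁ else 0
  | .B i, .C j => if i = j then l₂ else 0
  | .C j, .B i => if i = j then l₂ else 0
  | _, _ => 0

theorem linkLength_symm {n : ℕ} (l₁ l₂ : ℝ) (u v : Joint n) :
    linkLength l₁ l₂ u v = linkLength l₁ l₂ v u := by
  cases u <;> cases v <;> rfl

theorem linkLength_pos {n : ℕ} {l₁ l₂ : ℝ} (h₁ : 0 < l₁) (h₂ : 0 < l₂) (u v : Joint n)
    (h : (SimpleGraph.fromRel (IsLink (n := n))).Adj u v) : 0 < linkLength l₁ l₂ u v := by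
  rw [SimpleGraph.fromRel_adj] at h
  rcases h.2 with h | h <;> cases h <;> simp [linkLength, h₁, h₂]

/-- The tree linkage with `n` petals and link lengths `1`, `l₁`, `l₂`. -/
def petalLinkage (n : ℕ) (l₁ l₂ : ℝ) (h₁ : 0 < l₁) (h₂ : 0 < l₂) : Linkage (Joint n) where
  graph := SimpleGraph.fromRel IsLink
  length := linkLength l₁ l₂
  length_symm := linkLength_symm l₁ l₂
  length_pos := linkLength_pos h₁ h₂

/-- The index `i - 1` modulo `n`. -/
def prev {n : ℕ} (i : Fin n) : Fin n := ⟨(i.val + (n - 1)) % n, Nat.mod_lt _ i.pos⟩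

/-- The counterclockwise angle `∠ X O Y`, measured in `[0, 2π)`. -/
def ccwAngle (X O Y : ℂ) : ℝ := toIcoMod two_pi_pos 0 (Complex.arg ((Y - O) / (X - O)))

/-- The petal angle `θ_i = ∠ A_{i-1} O A_i`. -/
def petalAngle {n : ℕ} (p : Joint n → ℂ) (i : Fin n) : ℝ :=
  ccwAngle (p (.A (prev i))) (p .O) (p (.A i))

/-- `2π / n`. -/
def thetaBar (n : ℕ) : ℝ := 2 * π / n

/-- `β = arcsin l₁`. -/
def beta (l₁ : ℝ) : ℝ := arcsin l₁

/-- `α = (2π - β) / (n - 1)`. -/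
def alpha (n : ℕ) (l₁ : ℝ) : ℝ := (2 * π - beta l₁) / ((n : ℝ) - 1)

/-- `l_P(θ) = cos θ - √(l₁² - sin² θ)`. -/
def lP (l₁ θ : ℝ) : ℝ := cos θ - √(l₁ ^ 2 - sin θ ^ 2)

/-- `θ_m = arccos ((1 - l₁² + l₂²) / (2 l₂))`. -/
def thetaMin (l₁ l₂ : ℝ) : ℝ := arccos ((1 - l₁ ^ 2 + l₂ ^ 2) / (2 * l₂))

/-- The constraints on the parameters of the tree linkage. -/
structure Constraints (n : ℕ) (l₁ l₂ : ℝ) : Prop where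
  n_gt : 4 < n
  l₁_pos : 0 < l₁
  l₂_pos : 0 < l₂
  l₁_lt : l₁ < 1
  thetaBar_lt : thetaBar n < beta l₁
  l₂_lt : l₂ < lP l₁ (thetaBar n)
  l₂_gt : sin (beta l₁) * cos (beta l₁) < l₂
  one_lt : 1 < l₁ + l₂
  alpha_lt : alpha n l₁ < thetaMin l₁ l₂

/-- `P` is the leftmost intersection point of the circle with centre `A` and radius `r` with the
line through `O` and `A'`, that line being directed from `O` to `A'`. -/
def IsLeftmostIntersection (O A' A : ℂ) (r : ℝ) (P : ℂ) : Prop :=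
  ∃ s : ℝ, P = AffineMap.lineMap O A' s ∧ dist A P = r ∧
    ∀ s' : ℝ, dist A (AffineMap.lineMap O A' s') = r → s ≤ s'

/-- The open small arc between two points `P`, `Q` of the circle with centre `A` and radius `r`:
the points of the circle that lie inside the convex angle `∠ P A Q`. -/
def openSmallArc (A : ℂ) (r : ℝ) (P Q : ℂ) : Set ℂ :=
  {X | dist X A = r ∧ ∃ a b : ℝ, 0 < a ∧ 0 < b ∧ X - A = (a : ℂ) * (P - A) + (b : ℂ) * (Q - A)}

/-- `R` is the foot on the segment `X Y` of the perpendicular from `B`. -/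
def IsFoot (B X Y R : ℂ) : Prop :=
  R ∈ segment ℝ X Y ∧ inner ℝ (B - R) (Y - X) = 0

/-- Petal `i` is restricted: `θ < β`; `B` is on the open small arc `P Q` of the circle `𝒞` with
centre `A` and radius `l₁`, where `P` is the leftmost intersection of `𝒞` with the line `O A'` and
`Q` the intersection of `𝒞` with `O A`; and `C` is in the open region bounded by the quadrilateral
`O R B S`, where `R`, `S` are the feet of the perpendiculars from `B` to `O A'` and `O A`.
The quadrilateral has right angles at `R` and `S` and is convex, so that this region is the
interior of its convex hull. -/
def IsRestricted {n : ℕ} (l₁ : ℝ) (p : Joint n → ℂ) (i : Fin n) : Prop :=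
  petalAngle p i < beta l₁ ∧
  (∃ P Q : ℂ,
    IsLeftmostIntersection (p .O) (p (.A (prev i))) (p (.A i)) l₁ P ∧
    Q ∈ segment ℝ (p .O) (p (.A i)) ∧ dist (p (.A i)) Q = l₁ ∧
    p (.B i) ∈ openSmallArc (p (.A i)) l₁ P Q) ∧
  (∃ R S : ℂ,
    IsFoot (p (.B i)) (p .O) (p (.A (prev i))) R ∧
    IsFoot (p (.B i)) (p .O) (p (.A i)) S ∧
    p (.C i) ∈ interior (convexHull ℝ {p .O, R, p (.B i), S}))

/-- The links `O A_0, …, O A_{n-1}` (of length one) leave `O` in this counterclockwise cyclic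
order, going around `O` once. -/
def IsCcwOrdered {n : ℕ} (p : Joint n → ℂ) : Prop :=
  ∃ φ : Fin n → ℝ, StrictMono φ ∧ (∀ i j, φ j < φ i + 2 * π) ∧
    ∀ i, p (.A i) - p .O = Complex.exp ((φ i : ℂ) * Complex.I)

/-- The petals are in counterclockwise order, all petal angles are in `(α, β)`, and all petals
are restricted. -/
def IsLockedStart {n : ℕ} (l₁ : ℝ) (p : Joint n → ℂ) : Prop :=
  IsCcwOrdered p ∧ (∀ i, petalAngle p i ∈ Ioo (alpha n l₁) (beta l₁)) ∧ ∀ i, IsRestricted l₁ p i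

end

end PetalTree

open PetalTree

namespace PetalTree

/-! Locking is an open-and-closed argument. Place `O` at 0 and `A` at 1, and write `k = √(1 - l₁²) =
cos β`. Being restricted is encoded by ten real functions, `slack`: the angle `θ` has nonnegative
cosine and sine with `sin θ ≤ l₁`; `B` and `C` lie between the lines `OA'` and `OA`; `C` does not
pass the perpendiculars from `B` to these lines; and the coordinate of `B` along `OA` is at most `1
- l₁² = k²`, that of the points where the tangents from `O` touch the circle about `A`. This last
inequality replaces the arc condition. Strict inequalities, together with a bound keeping `angleSum`
near `2π`, define the open set `IsTrapped`; weak ones define the closed set `IsWeaklyTrapped`.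

On configurations the two sets agree. In `strict_of_weak`, an equality would put `B` or `C` on a
link `OA` or `OA'`, put `B` at a point of tangency on or beyond `OA'`, or make `BC` perpendicular to
an arm. The last needs room at least `l₂` inside the petal, while only `l₁ k = sin β cos β < l₂` is
available. The same lemma shows `θ ≥ θ_m`: the link `BC` forces `‖OB‖ ≥ l₂`, and the angle `AOB` of
the triangle with sides `1`, `l₁`, `‖OB‖` then is at least `θ_m`.

The one equality not excluded petal by petal is `sin θ = l₁`. There the petals cooperate: the angles
add up to `2π` and each exceeds `α`, so each is below `2π - (n - 1) α = β`
(`IsWeaklyTrapped.isTrapped`). Hence the trapped times of a motion form a clopen subset of an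
interval, and a start is trapped at time 0 (`IsLockedStart.isTrapped`).

Both witnesses for locking consist of rotated copies of one chain inside a sector
(`isConfiguration_rotatedPlacement`): straight radial chains that leave a small angle, and equally
spaced petals with `C` folded back onto the segment `OB`. -/

/-! ### Plane geometry of a single petal -/

/-- In the frame with `A = 1`, `A' = C - S i`, `B = u - h i`, `C = m - g i`: a weakly restricted
petal of a configuration is strictly restricted, and its angle is bounded below. -/
theorem strict_of_weak {l₁ l₂ C S u h m g : ℝ} (hl₁ : 0 < l₁) (hl₁' : l₁ < 1) (hl₂ : 0 < l₂)
    (hl : l₁ * √(1 - l₁ ^ 2) < l₂) (hCS : C ^ 2 + S ^ 2 = 1)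
    (hAB : (u - 1) ^ 2 + h ^ 2 = l₁ ^ 2) (hBC : (u - m) ^ 2 + (h - g) ^ 2 = l₂ ^ 2)
    (hC : 0 ≤ C) (hS : 0 ≤ S) (hSl : S ≤ l₁) (hBA' : 0 ≤ u * S - h * C) (hBA : 0 ≤ h)
    (hu : u ≤ 1 - l₁ ^ 2) (hCA' : 0 ≤ m * S - g * C) (hCA : 0 ≤ g)
    (hR : 0 ≤ (u - m) * C + (h - g) * S) (hS' : 0 ≤ u - m)
    (nS : S ≠ 0)
    (nBA' : u * S - h * C = 0 → 0 ≤ u * C + h * S → u * C + h * S ≤ 1 → False)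
    (nBA : h = 0 → 0 ≤ u → u ≤ 1 → False)
    (nCA' : m * S - g * C = 0 → 0 ≤ m * C + g * S → m * C + g * S ≤ 1 → False)
    (nCA : g = 0 → 0 ≤ m → m ≤ 1 → False) :
    0 < C ∧ 0 < S ∧ 0 < u * S - h * C ∧ 0 < h ∧ u < 1 - l₁ ^ 2 ∧ 0 < m * S - g * C ∧ 0 < g ∧
      0 < (u - m) * C + (h - g) * S ∧ 0 < u - m ∧ C ≤ (1 - l₁ ^ 2 + l₂ ^ 2) / (2 * l₂) := by
  have hk0 : 0 < 1 - l₁ ^ 2 := by nlinarith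
  set k := √(1 - l₁ ^ 2) with hk
  have hkpos : 0 < k := Real.sqrt_pos.2 hk0
  have hk2 : k ^ 2 = 1 - l₁ ^ 2 := Real.sq_sqrt hk0.le
  have hk1 : k < 1 := by
    refine lt_of_pow_lt_pow_left₀ 2 zero_le_one ?_
    linarith [pow_pos hl₁ 2]
  have hSpos : 0 < S := lt_of_le_of_ne hS (Ne.symm nS)
  have hkC : k ≤ C := by
    refine le_of_sq_le_sq ?_ hC
    nlinarith
  have hCpos : 0 < C := hkpos.trans_le hkC
  have hC1 : C ≤ 1 := by nlinarith
  have hhpos : 0 < h := by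
    refine lt_of_le_of_ne hBA fun h0 => ?_
    have h1 : (1 - u) ^ 2 = l₁ ^ 2 := by rw [← hAB, ← h0]; ring
    have h2 : 1 - u = l₁ := by
      refine (sq_eq_sq₀ ?_ hl₁.le).1 h1
      nlinarith
    exact nBA h0.symm (by linarith) (by linarith)
  have hBA'pos : 0 < u * S - h * C := by
    refine lt_of_le_of_ne hBA' fun h0 => ?_
    have e1 : u = (u * C + h * S) * C := by linear_combination -u * hCS - S * h0
    have e2 : h = (u * C + h * S) * S := by linear_combination -h * hCS + C * h0
    generalize u * C + h * S = r at *
    have r0 : 0 ≤ r := by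
      by_contra! hneg
      linarith [mul_neg_of_neg_of_pos hneg hSpos]
    refine nBA' h0.symm r0 ?_
    -- If `B` were on the ray `OA'` beyond `A'`, then `u > C ≥ C² ≥ k² = 1 - l₁²`, against `hu`.
    by_contra! hgt
    have h1 : C < r * C := lt_mul_of_one_lt_left hCpos hgt
    have h2 : k ^ 2 ≤ C ^ 2 := by gcongr
    have h3 : C ^ 2 ≤ C := pow_le_of_le_one hC hC1 two_ne_zero
    linarith
  -- Equality makes `B` the point of tangency, at angle `β` from `OA`; since `θ ≤ β`, it cannot be
  -- strictly inside the petal.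
  have huk : u < 1 - l₁ ^ 2 := by
    refine lt_of_le_of_ne hu fun h0 => ?_
    have h1 : h ^ 2 = (l₁ * k) ^ 2 := by rw [mul_pow, hk2]; nlinarith
    have h2 : h = l₁ * k := (sq_eq_sq₀ hhpos.le (by positivity)).1 h1
    rw [← hk2] at h0
    rw [h0, h2] at hBA'pos
    have h3 : k * S ≤ C * l₁ := mul_le_mul hkC hSl hS hC
    have h4 := mul_le_mul_of_nonneg_left h3 hkpos.le
    linarith
  have hgpos : 0 < g := by
    refine lt_of_le_of_ne hCA fun h0 => ?_
    rw [← h0] at hCA'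
    refine nCA h0.symm ?_ (by linarith [sq_nonneg l₁])
    by_contra! hneg
    linarith [mul_neg_of_neg_of_pos hneg hSpos]
  have hCA'pos : 0 < m * S - g * C := by
    refine lt_of_le_of_ne hCA' fun h0 => ?_
    have e2 : g = (m * C + g * S) * S := by linear_combination -g * hCS + C * h0
    have r0 : 0 ≤ m * C + g * S := by
      by_contra! hneg
      linarith [mul_neg_of_neg_of_pos hneg hSpos]
    refine nCA' h0.symm r0 ?_
    -- The projection of `C` to `OA'` does not pass that of `B`, which is at most `‖OB‖ ≤ 1`.
    have h1 : u * C + h * S ≤ 1 := by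
      refine le_of_sq_le_sq ?_ zero_le_one
      have : (u * C + h * S) ^ 2 = (u ^ 2 + h ^ 2) * (C ^ 2 + S ^ 2) - (u * S - h * C) ^ 2 := by
        ring
      rw [this, hCS]
      linarith [sq_nonneg (u * S - h * C), sq_nonneg l₁]
    linarith
  -- Otherwise `BC` is perpendicular to `OA`, so `h = g + l₂ > l₂`; but `1 - u ≥ l₁²` leaves `h ≤ l₁
  -- k`.
  have hS'pos : 0 < u - m := by
    refine lt_of_le_of_ne hS' fun h0 => ?_
    rw [← h0] at hR hBC
    have h1 : 0 ≤ h - g := by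
      by_contra! hneg
      linarith [mul_neg_of_neg_of_pos hneg hSpos]
    have h2 : h - g = l₂ := (sq_eq_sq₀ h1 hl₂.le).1 (by linarith)
    have h3 : h ≤ l₁ * k := by
      refine le_of_sq_le_sq ?_ (by positivity)
      have h4 : (l₁ ^ 2) ^ 2 ≤ (1 - u) ^ 2 := by
        gcongr
        linarith
      rw [mul_pow, hk2]
      linarith
    linarith
  -- Otherwise `BC` is perpendicular to `OA'`, and the distance `u S - h C` of `B` from that line
  -- exceeds `l₂`; but it is at most `u S ≤ k² l₁ ≤ k l₁`.
  have hRpos : 0 < (u - m) * C + (h - g) * S := by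
    refine lt_of_le_of_ne hR fun h0 => ?_
    have e1 : ((u - m) * S - (h - g) * C) ^ 2 = l₂ ^ 2 := by
      have : ((u - m) * S - (h - g) * C) ^ 2 + ((u - m) * C + (h - g) * S) ^ 2 =
        ((u - m) ^ 2 + (h - g) ^ 2) * (C ^ 2 + S ^ 2) := by ring
      rw [hCS, hBC, ← h0] at this
      linarith
    have e2 : u - m = ((u - m) * S - (h - g) * C) * S := by
      linear_combination -(u - m) * hCS - C * h0
    have d0 : 0 ≤ (u - m) * S - (h - g) * C := by
      by_contra! hneg
      linarith [mul_neg_of_neg_of_pos hneg hSpos]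
    have e3 := (sq_eq_sq₀ d0 hl₂.le).1 e1
    have e4 : u * S ≤ k ^ 2 * l₁ := by
      have h1 : u * S ≤ k ^ 2 * S := mul_le_mul_of_nonneg_right (hk2 ▸ hu) hS
      exact h1.trans (mul_le_mul_of_nonneg_left hSl (sq_nonneg k))
    have e5 : k ^ 2 * l₁ ≤ k * l₁ :=
      mul_le_mul_of_nonneg_right (pow_le_of_le_one hkpos.le hk1.le two_ne_zero) hl₁.le
    linarith [mul_pos hhpos hCpos]
  refine ⟨hCpos, hSpos, hBA'pos, hhpos, huk, hCA'pos, hgpos, hRpos, hS'pos, ?_⟩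
  -- The inner product of `OC` and `CB` is positive, because `OC` is a positive combination of the
  -- directions of the two arms. Hence `‖OB‖ ≥ ‖BC‖ = l₂`.
  have hd : 0 < m * (u - m) + g * (h - g) := by
    have : S * (m * (u - m) + g * (h - g)) =
        g * ((u - m) * C + (h - g) * S) + (m * S - g * C) * (u - m) := by ring
    exact pos_of_mul_pos_right (this ▸ by positivity) hS
  have hupos : 0 < u := by
    by_contra! hneg
    linarith [mul_pos hhpos hCpos, mul_nonpos_of_nonpos_of_nonneg hneg hS]
  have hN0 : 0 < u ^ 2 + h ^ 2 := by positivity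
  set r := √(u ^ 2 + h ^ 2) with hr
  have hrpos : 0 < r := Real.sqrt_pos.2 hN0
  have hr2 : r ^ 2 = u ^ 2 + h ^ 2 := Real.sq_sqrt hN0.le
  have hlr : l₂ ≤ r := by
    refine le_of_sq_le_sq ?_ hrpos.le
    linarith [sq_nonneg m, sq_nonneg g]
  have hrk : r ≤ k := by
    refine le_of_sq_le_sq ?_ hkpos.le
    linarith
  -- The petal angle is at least the angle `AOB`, whose cosine is `u / r = (r² + k²) / (2 r)`.
  have hCr : C * r ≤ u := by
    refine le_of_sq_le_sq ?_ hupos.le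
    rw [mul_pow, hr2]
    have : (h * C) ^ 2 ≤ (u * S) ^ 2 := by
      have : 0 < h * C := by positivity
      exact pow_le_pow_left₀ this.le (by linarith) 2
    have h3 : (u * S) ^ 2 = u ^ 2 - (u * C) ^ 2 := by linear_combination u ^ 2 * hCS
    linarith
  have hu2 : 2 * u = r ^ 2 + k ^ 2 := by rw [hr2, hk2]; linarith
  rw [← hk2, le_div_iff₀ (by positivity)]
  -- The function `r ↦ (r² + k²) / (2 r)` decreases up to `k`, and `l₂ ≤ r ≤ k`; the product in `h3`
  -- is this monotonicity with denominators cleared.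
  have h1 : C * (2 * l₂) * r ≤ (k ^ 2 + l₂ ^ 2) * r := by
    have h2 : r * l₂ ≤ k ^ 2 := by
      rw [sq]
      exact mul_le_mul hrk (hlr.trans hrk) hl₂.le hkpos.le
    have h3 : 0 ≤ (r - l₂) * (k ^ 2 - r * l₂) :=
      mul_nonneg (by linarith) (by linarith)
    have h4 : C * (2 * l₂) * r ≤ (r ^ 2 + k ^ 2) * l₂ := by
      rw [← hu2]
      linarith [mul_le_mul_of_nonneg_right hCr hl₂.le]
    linarith
  exact le_of_mul_le_mul_right h1 hrpos

/-! ### Frames, cyclic indices, and what simplicity of a configuration forbids -/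

open ComplexConjugate in
/-- `e^{iθ}` for the petal angle `θ` of a configuration. -/
def petalRot {n : ℕ} (p : Joint n → ℂ) (i : Fin n) : ℂ :=
  (p (.A i) - p .O) * conj (p (.A (prev i)) - p .O)

open ComplexConjugate in
/-- The position of a joint relative to the frame with origin `O` in which `A_i` is `1`. -/
def inFrame {n : ℕ} (p : Joint n → ℂ) (i : Fin n) (v : Joint n) : ℂ :=
  (p v - p .O) * conj (p (.A i) - p .O)

theorem val_prev {n : ℕ} (i : Fin n) :
    (prev i).val = if i.val = 0 then n - 1 else i.val - 1 := by
  have hi := i.isLt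
  unfold prev
  split_ifs with h
  · simp only [h, zero_add]
    exact Nat.mod_eq_of_lt (by omega)
  · have : i.val + (n - 1) = (i.val - 1) + n := by omega
    simp only [this, Nat.add_mod_right]
    exact Nat.mod_eq_of_lt (by omega)

theorem prev_injective {n : ℕ} : Function.Injective (prev : Fin n → Fin n) := by
  intro i j h
  have h' := congrArg Fin.val h
  rw [val_prev, val_prev] at h'
  have hi := i.isLt
  have hj := j.isLt
  ext
  split_ifs at h' <;> omega

theorem prev_bijective {n : ℕ} : Function.Bijective (prev : Fin n → Fin n) :=
  Finite.injective_iff_bijective.1 prev_injective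

theorem prev_ne {n : ℕ} (hn : 1 < n) (i : Fin n) : prev i ≠ i := by
  intro h
  have h' := congrArg Fin.val h
  rw [val_prev] at h'
  have hi := i.isLt
  split_ifs at h' <;> omega

theorem sum_comp_prev {n : ℕ} (f : Fin n → ℝ) : ∑ i, f (prev i) = ∑ i, f i :=
  prev_bijective.sum_comp f

section Adjacency

variable {n : ℕ} {l₁ l₂ : ℝ} {h₁ : 0 < l₁} {h₂ : 0 < l₂}

theorem petalLinkage_adj {u v : Joint n} :
    (petalLinkage n l₁ l₂ h₁ h₂).graph.Adj u v ↔ IsLink u v ∨ IsLink v u := by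
  refine (SimpleGraph.fromRel_adj _ _ _).trans ⟨fun h => h.2, fun h => ⟨?_, h⟩⟩
  rintro rfl
  rcases h with h | h <;> cases h

theorem adj_of_isLink {u v : Joint n} (h : IsLink u v) :
    (petalLinkage n l₁ l₂ h₁ h₂).graph.Adj u v :=
  petalLinkage_adj.2 (Or.inl h)

variable {p : Joint n → ℂ} (hp : (petalLinkage n l₁ l₂ h₁ h₂).IsConfiguration p)
include hp

theorem norm_OA (i : Fin n) : ‖p (.A i) - p .O‖ = 1 := by
  have := hp.dist_eq _ _ (adj_of_isLink (IsLink.OA i))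
  rwa [dist_comm, dist_eq_norm] at this

theorem norm_AB (i : Fin n) : ‖p (.B i) - p (.A i)‖ = l₁ := by
  have := hp.dist_eq _ _ (adj_of_isLink (IsLink.AB i))
  rw [dist_comm, dist_eq_norm] at this
  simpa [petalLinkage, linkLength] using this

theorem norm_BC (i : Fin n) : ‖p (.B i) - p (.C i)‖ = l₂ := by
  have := hp.dist_eq _ _ (adj_of_isLink (IsLink.BC i))
  rw [dist_eq_norm] at this
  simpa [petalLinkage, linkLength] using this

theorem A_injective {i j : Fin n} (h : p (.A i) = p (.A j)) : i = j := by
  by_contra hij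
  have h1 := hp.inter_eq _ _ _ (adj_of_isLink (IsLink.OA i)) (adj_of_isLink (IsLink.OA j))
    (by simpa using hij)
  have h2 : p (.A i) ∈ segment ℝ (p .O) (p (.A i)) ∩ segment ℝ (p .O) (p (.A j)) :=
    ⟨right_mem_segment _ _ _, h ▸ right_mem_segment _ _ _⟩
  rw [h1, mem_singleton_iff] at h2
  have h3 := norm_OA hp i
  simp [h2] at h3

theorem B_notMem_segment (i j : Fin n) : p (.B i) ∉ segment ℝ (p .O) (p (.A j)) := by
  intro h
  by_cases hij : i = j
  · subst hij
    have h1 := hp.inter_eq _ _ _ (adj_of_isLink (IsLink.OA i)).symm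
      (adj_of_isLink (IsLink.AB i)) (by simp)
    have h2 : p (.B i) ∈ segment ℝ (p (.A i)) (p .O) ∩ segment ℝ (p (.A i)) (p (.B i)) :=
      ⟨segment_symm ℝ (p .O) (p (.A i)) ▸ h, right_mem_segment _ _ _⟩
    rw [h1, mem_singleton_iff] at h2
    have h3 := norm_AB hp i
    rw [h2, sub_self, norm_zero] at h3
    exact h₁.ne h3
  · exact Set.disjoint_left.1 (hp.disjoint _ _ _ _ (adj_of_isLink (IsLink.OA j))
      (adj_of_isLink (IsLink.AB i)) (by simp) (by simp) (by simpa using Ne.symm hij) (by simp)) h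
      (right_mem_segment _ _ _)

theorem C_notMem_segment (i j : Fin n) : p (.C i) ∉ segment ℝ (p .O) (p (.A j)) := fun h =>
  Set.disjoint_left.1 (hp.disjoint _ _ _ _ (adj_of_isLink (IsLink.OA j))
    (adj_of_isLink (IsLink.BC i)) (by simp) (by simp) (by simp) (by simp)) h
    (right_mem_segment _ _ _)

end Adjacency

open ComplexConjugate in
/-- A point whose coordinate along a unit vector `Y - X` is in `[0, 1]`, and which has no
transversal coordinate, is on the segment `X Y`. -/
theorem mem_segment_of_frame {X Y W : ℂ} (hY : ‖Y - X‖ = 1)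
    (him : ((W - X) * conj (Y - X)).im = 0) (h0 : 0 ≤ ((W - X) * conj (Y - X)).re)
    (h1 : ((W - X) * conj (Y - X)).re ≤ 1) : W ∈ segment ℝ X Y := by
  set q := (W - X) * conj (Y - X) with hq
  have hu : (Y - X) * conj (Y - X) = 1 := by rw [Complex.mul_conj, Complex.normSq_eq_norm_sq, hY]; simp
  have hW : W = X + q * (Y - X) := by
    rw [hq]
    linear_combination -(W - X) * hu
  have hqr : q = (q.re : ℂ) := by
    apply Complex.ext <;> simp [him]
  refine ⟨1 - q.re, q.re, by linarith, h0, by ring, ?_⟩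
  rw [hW, hqr]
  simp only [Complex.real_smul, Complex.ofReal_re]
  push_cast
  ring

/-! ### The open trap and its closed version -/

/-- The quantities whose positivity expresses that petal `i` is restricted. -/
noncomputable def slack {n : ℕ} (l₁ : ℝ) (p : Joint n → ℂ) (i : Fin n) : Fin 10 → ℝ :=
  ![(petalRot p i).re, (petalRot p i).im, l₁ - (petalRot p i).im,
    (inFrame p i (.B i) * petalRot p i).im, -(inFrame p i (.B i)).im,
    1 - l₁ ^ 2 - (inFrame p i (.B i)).re,
    (inFrame p i (.C i) * petalRot p i).im, -(inFrame p i (.C i)).im,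
    ((inFrame p i (.B i) - inFrame p i (.C i)) * petalRot p i).re,
    (inFrame p i (.B i) - inFrame p i (.C i)).re]

/-- The sum of the petal angles, computed from their sines. -/
noncomputable def angleSum {n : ℕ} (p : Joint n → ℂ) : ℝ := ∑ i, arcsin (petalRot p i).im

theorem continuous_slack {n : ℕ} (l₁ : ℝ) (i : Fin n) (k : Fin 10) :
    Continuous fun p : Joint n → ℂ => slack l₁ p i k := by
  unfold slack petalRot inFrame
  fin_cases k <;> simp <;> fun_prop

theorem continuous_angleSum {n : ℕ} : Continuous (angleSum (n := n)) := by
  unfold angleSum petalRot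
  refine continuous_finsetSum _ fun i _ => Real.continuous_arcsin.comp ?_
  fun_prop

/-- All petals are strictly restricted, and the petals go around `O` once. -/
def IsTrapped {n : ℕ} (l₁ : ℝ) (p : Joint n → ℂ) : Prop :=
  (∀ i k, 0 < slack l₁ p i k) ∧ |angleSum p - 2 * π| < 1

/-- The closed version of `IsTrapped`. -/
def IsWeaklyTrapped {n : ℕ} (l₁ : ℝ) (p : Joint n → ℂ) : Prop :=
  (∀ i k, 0 ≤ slack l₁ p i k) ∧ |angleSum p - 2 * π| ≤ 1

theorem IsTrapped.weakly {n : ℕ} {l₁ : ℝ} {p : Joint n → ℂ} (h : IsTrapped l₁ p) :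
    IsWeaklyTrapped l₁ p :=
  ⟨fun i k => (h.1 i k).le, h.2.le⟩

theorem isOpen_isTrapped {n : ℕ} (l₁ : ℝ) : IsOpen {p : Joint n → ℂ | IsTrapped l₁ p} := by
  unfold IsTrapped
  simp only [ofPred_and, ofPred_forall]
  refine IsOpen.inter ?_ (isOpen_lt ?_ continuous_const)
  · exact isOpen_iInter_of_finite fun i => isOpen_iInter_of_finite fun k =>
      isOpen_lt continuous_const (continuous_slack l₁ i k)
  · exact (continuous_angleSum.sub continuous_const).abs

theorem isClosed_isWeaklyTrapped {n : ℕ} (l₁ : ℝ) :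
    IsClosed {p : Joint n → ℂ | IsWeaklyTrapped l₁ p} := by
  unfold IsWeaklyTrapped
  simp only [ofPred_and, ofPred_forall]
  refine IsClosed.inter ?_ (isClosed_le ?_ continuous_const)
  · exact isClosed_iInter fun i => isClosed_iInter fun k =>
      isClosed_le continuous_const (continuous_slack l₁ i k)
  · exact (continuous_angleSum.sub continuous_const).abs

section Trap

variable {n : ℕ} {l₁ l₂ : ℝ} {h₁ : 0 < l₁} {h₂ : 0 < l₂} {p : Joint n → ℂ}
  (hp : (petalLinkage n l₁ l₂ h₁ h₂).IsConfiguration p)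
include hp

open ComplexConjugate

theorem arm_mul_conj (i : Fin n) : (p (.A i) - p .O) * conj (p (.A i) - p .O) = 1 := by
  rw [Complex.mul_conj, Complex.normSq_eq_norm_sq, norm_OA hp]
  simp

theorem norm_petalRot (i : Fin n) : ‖petalRot p i‖ = 1 := by
  rw [petalRot, norm_mul, RCLike.norm_conj, norm_OA hp, norm_OA hp, one_mul]

theorem inFrame_mul_petalRot (i : Fin n) (v : Joint n) :
    inFrame p i v * petalRot p i = inFrame p (prev i) v := by
  unfold inFrame petalRot
  linear_combination (p v - p .O) * conj (p (.A (prev i)) - p .O) * arm_mul_conj hp i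

theorem inFrame_A (i : Fin n) : inFrame p i (.A i) = 1 := arm_mul_conj hp i

theorem norm_inFrame_sub (i : Fin n) (v w : Joint n) :
    ‖inFrame p i v - inFrame p i w‖ = ‖p v - p w‖ := by
  unfold inFrame
  rw [← sub_mul, norm_mul, RCLike.norm_conj, norm_OA hp, mul_one]
  congr 1
  ring

theorem petalRot_sq (i : Fin n) : (petalRot p i).re ^ 2 + (petalRot p i).im ^ 2 = 1 := by
  have := Complex.sq_norm (petalRot p i)
  rw [norm_petalRot hp, Complex.normSq_apply] at this
  linarith

/-- A zero sine with nonnegative cosine means that two neighbouring arms coincide. -/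
theorem petalRot_im_ne_zero (hn : 1 < n) (i : Fin n) (h : 0 ≤ (petalRot p i).re) :
    (petalRot p i).im ≠ 0 := by
  intro h0
  have h1 := petalRot_sq hp i
  have h2 : (petalRot p i).re = 1 := by
    rw [h0] at h1
    nlinarith
  have h3 : petalRot p i = 1 := Complex.ext (by simpa using h2) (by simpa using h0)
  have h4 : p (.A i) - p .O = p (.A (prev i)) - p .O := by
    unfold petalRot at h3
    linear_combination (p (.A (prev i)) - p .O) * h3 -
      (p (.A i) - p .O) * arm_mul_conj hp (prev i)
  exact prev_ne hn i (A_injective hp (sub_left_inj.1 h4)).symm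

/-- This is `strict_of_weak` fed with the non-crossing conditions. Index 2, the slack `l₁ - sin θ`,
is left out: it becomes strict only through the sum of all angles. -/
theorem slack_pos_of_nonneg (hn : 1 < n) (hl₁ : l₁ < 1) (hl : l₁ * √(1 - l₁ ^ 2) < l₂)
    (i : Fin n) (hs : ∀ k, 0 ≤ slack l₁ p i k) :
    (∀ k, k ≠ 2 → 0 < slack l₁ p i k) ∧
      (petalRot p i).re ≤ (1 - l₁ ^ 2 + l₂ ^ 2) / (2 * l₂) := by
  have key := strict_of_weak (l₁ := l₁) (l₂ := l₂) (C := (petalRot p i).re)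
    (S := (petalRot p i).im) (u := (inFrame p i (.B i)).re) (h := -(inFrame p i (.B i)).im)
    (m := (inFrame p i (.C i)).re) (g := -(inFrame p i (.C i)).im) h₁ hl₁ h₂ hl
    (petalRot_sq hp i)
  have eB := inFrame_mul_petalRot hp i (.B i)
  have eC := inFrame_mul_petalRot hp i (.C i)
  have eBi := congrArg Complex.im eB
  have eBr := congrArg Complex.re eB
  have eCi := congrArg Complex.im eC
  have eCr := congrArg Complex.re eC
  simp only [slack, Fin.forall_fin_succ, Fin.isValue, Matrix.cons_val_zero, Matrix.cons_val_succ,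
    IsEmpty.forall_iff, and_true] at hs ⊢
  simp only [Complex.mul_re, Complex.mul_im, Complex.sub_re, Complex.sub_im] at hs eBi eBr eCi eCr
  obtain ⟨s0, s1, s2, s3, s4, s5, s6, s7, s8, s9⟩ := hs
  have nAB := norm_inFrame_sub hp i (.B i) (.A i)
  rw [norm_AB hp, inFrame_A hp] at nAB
  have nBC := norm_inFrame_sub hp i (.B i) (.C i)
  rw [norm_BC hp] at nBC
  have nAB' := Complex.sq_norm (inFrame p i (.B i) - 1)
  have nBC' := Complex.sq_norm (inFrame p i (.B i) - inFrame p i (.C i))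
  rw [nAB, Complex.normSq_apply] at nAB'
  rw [nBC, Complex.normSq_apply] at nBC'
  simp only [Complex.sub_re, Complex.sub_im, Complex.one_re, Complex.one_im] at nAB' nBC'
  have := key (by linarith) (by linarith) s0 s1 (by linarith) (by linarith) s4 (by linarith)
    (by linarith) s7 (by linarith) s9 (petalRot_im_ne_zero hp hn i s0)
    (fun a b c => B_notMem_segment hp i (prev i) (mem_segment_of_frame (norm_OA hp _)
      (eBi.symm.trans (by linarith)) (eBr.symm.ge.trans' (by linarith))
      (eBr.symm.le.trans (by linarith))))
    (fun a b c => B_notMem_segment hp i i (mem_segment_of_frame (norm_OA hp _)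
      (neg_eq_zero.1 a) b c))
    (fun a b c => C_notMem_segment hp i (prev i) (mem_segment_of_frame (norm_OA hp _)
      (eCi.symm.trans (by linarith)) (eCr.symm.ge.trans' (by linarith))
      (eCr.symm.le.trans (by linarith))))
    (fun a b c => C_notMem_segment hp i i (mem_segment_of_frame (norm_OA hp _)
      (neg_eq_zero.1 a) b c))
  obtain ⟨t0, t1, t2, t3, t4, t5, t6, t7, t8, t9⟩ := this
  simp only [Complex.mul_re, Complex.mul_im, Complex.sub_re, Complex.sub_im]
  refine ⟨⟨fun _ => t0, fun _ => t1, fun h => absurd rfl h, fun _ => by linarith, fun _ => t3,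
    fun _ => by linarith, fun _ => by linarith, fun _ => t6, fun _ => by linarith,
    fun _ => t8⟩, t9⟩

theorem cos_arcsin_petalRot (i : Fin n) (h : 0 ≤ (petalRot p i).re) :
    cos (arcsin (petalRot p i).im) = (petalRot p i).re := by
  rw [cos_arcsin, ← petalRot_sq hp i, add_sub_cancel_right, sqrt_sq h]

theorem exp_arcsin_petalRot (i : Fin n) (h : 0 ≤ (petalRot p i).re) :
    Complex.exp (arcsin (petalRot p i).im * Complex.I) = petalRot p i := by
  have h1 := petalRot_sq hp i
  have h2 : |(petalRot p i).im| ≤ 1 := abs_le_one_iff_mul_self_le_one.2 (by nlinarith)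
  apply Complex.ext
  · rw [Complex.exp_ofReal_mul_I_re, cos_arcsin_petalRot hp i h]
  · rw [Complex.exp_ofReal_mul_I_im, sin_arcsin (abs_le.1 h2).1 (abs_le.1 h2).2]

theorem prod_petalRot : ∏ i, petalRot p i = 1 := by
  unfold petalRot
  rw [Finset.prod_mul_distrib, prev_bijective.prod_comp fun i => conj (p (.A i) - p .O),
    ← Finset.prod_mul_distrib]
  exact Finset.prod_eq_one fun i _ => arm_mul_conj hp i

/-- The rotations from each arm to the next multiply to 1, so the sum is an integer multiple of
`2π`. The tolerance 1 is arbitrary below `2π`; it selects the multiple without any lifting of angles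
along the motion. -/
theorem angleSum_eq (h : ∀ i, 0 ≤ (petalRot p i).re) (ha : |angleSum p - 2 * π| ≤ 1) :
    angleSum p = 2 * π := by
  have h1 : Complex.exp (angleSum p * Complex.I) = 1 := by
    unfold angleSum
    push_cast
    rw [Finset.sum_mul, Complex.exp_sum, ← prod_petalRot hp]
    exact Finset.prod_congr rfl fun i _ => exp_arcsin_petalRot hp i (h i)
  obtain ⟨m, hm⟩ := Complex.exp_eq_one_iff.1 h1
  have h2 : angleSum p = m * (2 * π) := by
    have := congrArg Complex.im hm
    simpa using this
  rw [h2] at ha ⊢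
  have h3 : (m : ℝ) * (2 * π) - 2 * π = (m - 1 : ℤ) * (2 * π) := by push_cast; ring
  rw [h3, abs_mul, abs_of_pos two_pi_pos] at ha
  have h4 : m - 1 = 0 := by
    rw [← Int.abs_lt_one_iff]
    have h5 : ((|m - 1| : ℤ) : ℝ) < 1 := by
      rw [Int.cast_abs]
      by_contra! h6
      nlinarith [pi_gt_three]
    exact_mod_cast h5
  have : m = 1 := by omega
  simp [this]

end Trap

/-! ### Petal angles, the constraints, and the clopen argument -/

theorem ccwAngle_eq {X O Y : ℂ} {δ : ℝ} (hX : X - O ≠ 0) (h0 : 0 ≤ δ) (h1 : δ < 2 * π)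
    (h : Y - O = (X - O) * Complex.exp (δ * Complex.I)) : ccwAngle X O Y = δ := by
  unfold ccwAngle
  rw [h, mul_div_cancel_left₀ _ hX, Complex.arg_exp]
  simp only [Complex.mul_im, Complex.ofReal_re, Complex.I_im, mul_one, Complex.ofReal_im,
    Complex.I_re, mul_zero, add_zero]
  rw [toIcoMod_eq_iff]
  refine ⟨⟨h0, by simpa using h1⟩, -toIocDiv two_pi_pos (-π) δ, ?_⟩
  rw [toIocMod]
  simp [sub_eq_add_neg]

namespace Constraints

variable {n : ℕ} {l₁ l₂ : ℝ} (hc : Constraints n l₁ l₂)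
include hc

theorem sin_beta : sin (beta l₁) = l₁ :=
  sin_arcsin (by linarith [hc.l₁_pos]) hc.l₁_lt.le

omit hc in
theorem cos_beta : cos (beta l₁) = √(1 - l₁ ^ 2) := cos_arcsin l₁

theorem mul_sqrt_lt : l₁ * √(1 - l₁ ^ 2) < l₂ := by
  have := hc.l₂_gt
  rwa [hc.sin_beta, cos_beta] at this

theorem n_sub_one_pos : 0 < (n : ℝ) - 1 := by
  have : (4 : ℝ) < n := by exact_mod_cast hc.n_gt
  linarith

theorem beta_pos : 0 < beta l₁ := arcsin_pos.2 hc.l₁_pos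

theorem beta_lt : beta l₁ < π / 2 := arcsin_lt_pi_div_two.2 hc.l₁_lt

theorem sub_one_mul_alpha : ((n : ℝ) - 1) * alpha n l₁ = 2 * π - beta l₁ :=
  mul_div_cancel₀ _ hc.n_sub_one_pos.ne'

theorem alpha_pos : 0 < alpha n l₁ :=
  div_pos (by linarith [hc.beta_lt, pi_pos]) hc.n_sub_one_pos

end Constraints

section Motion

variable {n : ℕ} {l₁ l₂ : ℝ} (hc : Constraints n l₁ l₂) {p : Joint n → ℂ}
  (hp : (petalLinkage n l₁ l₂ hc.l₁_pos hc.l₂_pos).IsConfiguration p)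
include hp

theorem petalAngle_eq_arcsin (i : Fin n) (h0 : 0 ≤ (petalRot p i).re)
    (h1 : 0 ≤ (petalRot p i).im) : petalAngle p i = arcsin (petalRot p i).im := by
  refine ccwAngle_eq ?_ (arcsin_nonneg.2 h1) ?_ ?_
  · rw [← norm_ne_zero_iff, norm_OA hp]
    exact one_ne_zero
  · linarith [arcsin_le_pi_div_two (petalRot p i).im, pi_pos]
  · rw [exp_arcsin_petalRot hp i h0]
    unfold petalRot
    linear_combination -(p (.A i) - p .O) * arm_mul_conj hp (prev i)

-- The lower bound `θ_m` holds for each petal separately and exceeds `α`. The upper bound `β`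
-- follows from `n - 1` lower bounds and the total `2π`, by the choice of `α`; it supplies the
-- missing slack `l₁ - sin θ`.
include hc in
theorem IsWeaklyTrapped.isTrapped (hw : IsWeaklyTrapped l₁ p) :
    IsTrapped l₁ p ∧ ∀ i, petalAngle p i ∈ Ioo (alpha n l₁) (beta l₁) := by
  have hn : 1 < n := by have := hc.n_gt; omega
  have hstep := fun i =>
    slack_pos_of_nonneg hp hn hc.l₁_lt hc.mul_sqrt_lt i (hw.1 i)
  have hre : ∀ i, 0 ≤ (petalRot p i).re := fun i => hw.1 i 0
  have him : ∀ i, 0 ≤ (petalRot p i).im := fun i => hw.1 i 1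
  have hsum := angleSum_eq hp hre hw.2
  have hlow : ∀ i, alpha n l₁ < arcsin (petalRot p i).im := fun i => by
    refine hc.alpha_lt.trans_le ?_
    have h1 := arccos_le_arccos (hstep i).2
    rw [← cos_arcsin_petalRot hp i (hre i), arccos_cos (arcsin_nonneg.2 (him i))
      (by linarith [arcsin_le_pi_div_two (petalRot p i).im, pi_pos])] at h1
    exact h1
  have hhigh : ∀ i, arcsin (petalRot p i).im < beta l₁ := fun j => by
    have h1 : ∑ _i ∈ Finset.univ.erase j, alpha n l₁ <
        ∑ i ∈ Finset.univ.erase j, arcsin (petalRot p i).im := by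
      refine Finset.sum_lt_sum_of_nonempty ⟨prev j, ?_⟩ fun i _ => hlow i
      simpa using prev_ne hn j
    rw [Finset.sum_const, Finset.card_erase_of_mem (Finset.mem_univ j), Finset.card_univ,
      Fintype.card_fin, nsmul_eq_mul, Nat.cast_sub hn.le, Nat.cast_one,
      hc.sub_one_mul_alpha] at h1
    have h2 := Finset.add_sum_erase Finset.univ (fun i => arcsin (petalRot p i).im)
      (Finset.mem_univ j)
    unfold angleSum at hsum
    linarith
  refine ⟨⟨fun i k => ?_, by simp [hsum]⟩, fun i => ?_⟩
  · by_cases hk : k = 2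
    · subst hk
      have : (petalRot p i).im < l₁ := by
        by_contra! hge
        exact (hhigh i).not_ge (monotone_arcsin hge)
      exact sub_pos.2 this
    · exact (hstep i).1 k hk
  · rw [petalAngle_eq_arcsin hc hp i (hre i) (him i)]
    exact ⟨hlow i, hhigh i⟩

omit hp in
theorem Linkage.IsMotion.petalAngle_mem {γ : unitInterval → Joint n → ℂ}
    (hγ : (petalLinkage n l₁ l₂ hc.l₁_pos hc.l₂_pos).IsMotion γ) (h0 : IsTrapped l₁ (γ 0))
    (t : unitInterval) (i : Fin n) : petalAngle (γ t) i ∈ Ioo (alpha n l₁) (beta l₁) := by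
  have heq : {t | IsTrapped l₁ (γ t)} = {t | IsWeaklyTrapped l₁ (γ t)} := by
    ext t
    exact ⟨fun h => h.weakly, fun h => (h.isTrapped hc (hγ.isConfiguration t)).1⟩
  have hopen : IsOpen {t | IsTrapped l₁ (γ t)} := (isOpen_isTrapped l₁).preimage hγ.continuous
  have hclosed : IsClosed {t | IsTrapped l₁ (γ t)} :=
    heq ▸ (isClosed_isWeaklyTrapped l₁).preimage hγ.continuous
  have huniv := IsClopen.eq_univ ⟨hclosed, hopen⟩ ⟨0, h0⟩
  have ht : t ∈ {t | IsTrapped l₁ (γ t)} := huniv ▸ mem_univ t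
  exact (IsWeaklyTrapped.isTrapped hc (hγ.isConfiguration t) (IsTrapped.weakly ht)).2 i

end Motion

/-! ### A start is trapped -/

/-- The petal angles of a placement with arms in counterclockwise order. -/
theorem petalAngle_of_ordered {n : ℕ} (hn : 1 < n) {p : Joint n → ℂ} {φ : Fin n → ℝ}
    (hmono : StrictMono φ) (hlt : ∀ i j, φ j < φ i + 2 * π)
    (hφ : ∀ i, p (.A i) - p .O = Complex.exp ((φ i : ℂ) * Complex.I)) (i : Fin n) :
    petalAngle p i = φ i - φ (prev i) + if i.val = 0 then 2 * π else 0 := by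
  have hv := val_prev i
  refine ccwAngle_eq (by rw [hφ]; exact Complex.exp_ne_zero _) ?_ ?_ ?_
  · split_ifs with h
    · linarith [hlt i (prev i)]
    · rw [if_neg h] at hv
      have : prev i < i := Fin.lt_def.2 (by omega)
      linarith [hmono this]
  · split_ifs with h
    · rw [if_pos h] at hv
      have : i < prev i := Fin.lt_def.2 (by omega)
      linarith [hmono this]
    · linarith [hlt (prev i) i]
  · rw [hφ, hφ, ← Complex.exp_add, Complex.exp_eq_exp_iff_exists_int]
    split_ifs with h
    · exact ⟨-1, by push_cast; ring⟩
    · exact ⟨0, by push_cast; ring⟩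

theorem sum_petalAngle_of_ordered {n : ℕ} (hn : 1 < n) {p : Joint n → ℂ}
    (hp : IsCcwOrdered p) : ∑ i, petalAngle p i = 2 * π := by
  obtain ⟨φ, hmono, hlt, hφ⟩ := hp
  simp_rw [petalAngle_of_ordered hn hmono hlt hφ]
  rw [Finset.sum_add_distrib, Finset.sum_sub_distrib, sum_comp_prev, sub_self, zero_add]
  have : ∀ i : Fin n, (i.val = 0) ↔ i = ⟨0, by omega⟩ := fun i => by simp [Fin.ext_iff]
  simp [this]

/-- A nonconstant affine function that is nonnegative on a set cannot vanish at an interior point of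
its hull. It is applied to the four sides of the quadrilateral `ORBS`. -/
theorem pos_of_mem_interior_convexHull {s : Set ℂ} {o q c : ℂ} {t : ℝ} (hq : q ≠ 0)
    (hs : ∀ w ∈ s, 0 ≤ ((w - o) * q).re + t) (hc : c ∈ interior (convexHull ℝ s)) :
    0 < ((c - o) * q).re + t := by
  set f : ℂ → ℝ := fun w => ((w - o) * q).re + t with hf
  have hconv : Convex ℝ {w | 0 ≤ f w} := by
    intro x hx y hy a b ha hb hab
    have : f (a • x + b • y) = a * f x + b * f y := by
      simp only [hf, Complex.real_smul, Complex.mul_re, Complex.mul_im, Complex.add_re,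
        Complex.add_im, Complex.sub_re, Complex.sub_im, Complex.ofReal_re, Complex.ofReal_im]
      linear_combination (o.re * q.re - o.im * q.im - t) * hab
    simp only [mem_ofPred_eq] at hx hy ⊢
    rw [this]
    positivity
  have hsub : convexHull ℝ s ⊆ {w | 0 ≤ f w} := convexHull_min hs hconv
  have h1 : c ∈ interior {w | 0 ≤ f w} := interior_mono hsub hc
  obtain ⟨ε, hε, hball⟩ := Metric.isOpen_iff.1 isOpen_interior c h1
  have hqn : 0 < ‖q‖ := norm_pos_iff.2 hq
  -- The gradient of `f` is `conj q`; this is a step of length `ε / 2` along it, to be subtracted.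
  set d : ℂ := ((ε / (2 * ‖q‖) : ℝ) : ℂ) * (starRingEnd ℂ) q with hd
  have hmem : c - d ∈ Metric.ball c ε := by
    rw [Metric.mem_ball, dist_eq_norm, sub_sub_cancel_left, norm_neg, hd, norm_mul,
      RCLike.norm_conj, Complex.norm_real, Real.norm_of_nonneg (by positivity)]
    field_simp
    norm_num
  have h2 : c - d ∈ {w | 0 ≤ f w} := interior_subset (hball hmem)
  rw [mem_ofPred_eq] at h2
  have h3 : f (c - d) = f c - ε / (2 * ‖q‖) * ‖q‖ ^ 2 := by
    rw [Complex.sq_norm, Complex.normSq_apply]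
    simp only [hf, hd, Complex.mul_re, Complex.mul_im, Complex.sub_re, Complex.sub_im,
      Complex.ofReal_re, Complex.ofReal_im, Complex.conj_re, Complex.conj_im]
    ring
  have h4 : 0 < ε / (2 * ‖q‖) * ‖q‖ ^ 2 := by positivity
  linarith

/-- In the frame with `A = 1`, `A' = C - S i`, `P = s A'`, `B = u - h i`: a point `B` of the open
small arc `P Q` is inside the petal, and nearer to `O` than the points of tangency. -/
theorem of_mem_arc {l₁ C S s u h x y : ℝ} (hl₁ : 0 < l₁) (hl₁' : l₁ < 1) (hCS : C ^ 2 + S ^ 2 = 1)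
    (hC : 0 < C) (hS : 0 < S) (hSl : S < l₁) (hs : s ^ 2 - 2 * s * C + 1 = l₁ ^ 2)
    (hsC : s ≤ C) (hAB : (u - 1) ^ 2 + h ^ 2 = l₁ ^ 2) (hx : 0 < x) (hy : 0 < y)
    (hu : u - 1 = x * (s * C - 1) - y * l₁) (hh : h = x * (s * S)) :
    0 < h ∧ 0 < u * S - h * C ∧ u < 1 - l₁ ^ 2 := by
  have hl2 : l₁ ^ 2 < 1 := by nlinarith
  have hs0 : 0 < s := by
    by_contra! h0
    nlinarith
  have hsC' : s < C := by
    refine lt_of_le_of_ne hsC fun h0 => ?_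
    rw [h0] at hs
    have : S ^ 2 < l₁ ^ 2 := by gcongr
    nlinarith
  -- The nearer intersection `P` lies before the point of tangency: `s C < 1 - l₁²` amounts to `s <
  -- C`.
  have hκ : l₁ ^ 2 < 1 - s * C := by nlinarith
  have hP : (1 - s * C) ^ 2 + (s * S) ^ 2 = l₁ ^ 2 := by
    rw [← hs]
    linear_combination s ^ 2 * hCS
  -- This is `‖AB‖² = l₁²` expanded in the vectors `AP` and `AQ`, both of length `l₁`.
  have hrel : l₁ ^ 2 = (x ^ 2 + y ^ 2) * l₁ ^ 2 + 2 * x * y * (1 - s * C) * l₁ := by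
    have h1 : u - 1 = -(x * (1 - s * C) + y * l₁) := by rw [hu]; ring
    rw [h1, hh] at hAB
    linear_combination -hAB + x ^ 2 * hP
  have hxy : 0 < x * y * l₁ := by positivity
  have hlt := mul_lt_mul_of_pos_left hκ hxy
  refine ⟨by rw [hh]; positivity, ?_, ?_⟩
  · have h1 : u * S - h * C = S * (1 - (x + y * l₁)) := by
      rw [hh]
      linear_combination S * hu
    rw [h1]
    refine mul_pos hS (sub_pos.2 ?_)
    refine lt_of_pow_lt_pow_left₀ 2 zero_le_one ?_
    refine lt_of_mul_lt_mul_left ?_ (sq_nonneg l₁)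
    have h2 : y ^ 2 * l₁ ^ 2 * l₁ ^ 2 < y ^ 2 * l₁ ^ 2 * 1 := by gcongr
    linarith
  · have hκ0 : 0 < 1 - s * C := lt_trans (by positivity) hκ
    have h1 : l₁ ^ 2 < x * (1 - s * C) + y * l₁ := by
      refine lt_of_pow_lt_pow_left₀ 2 (by positivity) ?_
      have hx1 : x ^ 2 ≤ 1 := by
        refine le_of_mul_le_mul_right ?_ (pow_pos hl₁ 2)
        have : 0 < y ^ 2 * l₁ ^ 2 + 2 * x * y * (1 - s * C) * l₁ := by positivity
        linarith
      have h2 : (x * (1 - s * C) + y * l₁) ^ 2 = l₁ ^ 2 - x ^ 2 * (s * S) ^ 2 := by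
        linear_combination x ^ 2 * hP - hrel
      have h3 : x ^ 2 * (s * S) ^ 2 ≤ 1 * (s * S) ^ 2 := by gcongr
      have h4 : (l₁ ^ 2) ^ 2 < (1 - s * C) ^ 2 := by gcongr
      linarith
    linarith

section

variable {O A' A B : ℂ}

open ComplexConjugate

theorem sq_dist_lineMap (hA : ‖A - O‖ = 1) (hA' : ‖A' - O‖ = 1) (s : ℝ) :
    dist A (AffineMap.lineMap O A' s) ^ 2 =
      s ^ 2 - 2 * s * ((A - O) * conj (A' - O)).re + 1 := by
  have h1 : dist A (AffineMap.lineMap O A' s) = ‖(A - O) - s * (A' - O)‖ := by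
    rw [dist_eq_norm, AffineMap.lineMap_apply_module']
    congr 1
    simp only [Complex.real_smul]
    ring
  have h2 := Complex.sq_norm (A - O)
  have h3 := Complex.sq_norm (A' - O)
  rw [hA, Complex.normSq_apply] at h2
  rw [hA', Complex.normSq_apply] at h3
  rw [h1, Complex.sq_norm, Complex.normSq_apply]
  simp only [Complex.sub_re, Complex.sub_im, Complex.mul_re, Complex.mul_im, Complex.ofReal_re,
    Complex.ofReal_im, Complex.conj_re, Complex.conj_im] at *
  linear_combination -h2 - s ^ 2 * h3

theorem eq_of_isFoot {R : ℂ} (hA : ‖A - O‖ = 1) (h : IsFoot B O A R) :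
    R - O = ((B - O) * conj (A - O)).re * (A - O) ∧ 0 ≤ ((B - O) * conj (A - O)).re := by
  obtain ⟨⟨a, b, ha, hb, hab, rfl⟩, h⟩ := h
  have h0 : a • O + b • A - O = b * (A - O) := by
    have : (a : ℂ) + b = 1 := by exact_mod_cast hab
    simp only [Complex.real_smul]
    linear_combination O * this
  have h2 := Complex.sq_norm (A - O)
  rw [hA, Complex.normSq_apply] at h2
  have h3 : B - (a • O + b • A) = (B - O) - b * (A - O) := by
    rw [← h0]
    ring
  rw [h3, Complex.inner] at h
  have h4 : ((B - O) * conj (A - O)).re = b := by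
    simp only [Complex.sub_re, Complex.sub_im, Complex.mul_re, Complex.mul_im, Complex.ofReal_re,
      Complex.ofReal_im, Complex.conj_re, Complex.conj_im] at *
    linear_combination h - b * h2
  rw [h4]
  exact ⟨h0, hb⟩

end

section Start

variable {n : ℕ} {l₁ l₂ : ℝ} (hc : Constraints n l₁ l₂) {p : Joint n → ℂ}
  (hp : (petalLinkage n l₁ l₂ hc.l₁_pos hc.l₂_pos).IsConfiguration p)
include hp

open ComplexConjugate

theorem slack_pos_of_isRestricted {i : Fin n} (h0 : 0 < (petalRot p i).re)
    (h1 : 0 < (petalRot p i).im) (h2 : (petalRot p i).im < l₁) (hr : IsRestricted l₁ p i)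
    (k : Fin 10) : 0 < slack l₁ p i k := by
  obtain ⟨-, ⟨P, Q, ⟨s, rfl, hPA, hmin⟩, hQ, hQA, hBA, x, y, hx, hy, hB⟩, R, S, hR, hS, hC⟩ := hr
  have hCS := petalRot_sq hp i
  have hz : petalRot p i = (p (.A i) - p .O) * conj (p (.A (prev i)) - p .O) := rfl
  have hlm := sq_dist_lineMap (norm_OA hp i) (norm_OA hp (prev i))
  rw [← hz] at hlm
  have hs := hlm s
  rw [hPA] at hs
  -- The two intersections of line and circle have parameters `s` and `2 cos θ - s`; leftmost means
  -- that `s` is the smaller.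
  have hsC : s ≤ (petalRot p i).re := by
    have h3 := hlm (2 * (petalRot p i).re - s)
    have h4 := hmin _ ((sq_eq_sq₀ dist_nonneg hc.l₁_pos.le).1 (h3.trans (by rw [hs]; ring)))
    linarith
  have hQ' : Q - p (.A i) = -l₁ * (p (.A i) - p .O) := by
    obtain ⟨a, b, ha, hb, hab, rfl⟩ := hQ
    have hab' : (a : ℂ) = 1 - b := by
      rw [eq_sub_iff_add_eq]
      exact_mod_cast hab
    have h3 : a • p .O + b • p (.A i) - p (.A i) = -a * (p (.A i) - p .O) := by
      simp only [Complex.real_smul]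
      rw [hab']
      ring
    rw [dist_comm, dist_eq_norm, h3, norm_mul, norm_OA hp, norm_neg, Complex.norm_real,
      Real.norm_of_nonneg ha, mul_one] at hQA
    rw [h3, hQA]
  have hw : inFrame p i (.B i) - 1 = x * (s * conj (petalRot p i) - 1) + y * (-l₁) := by
    have hu := arm_mul_conj hp i
    have h3 : p (.B i) - p (.A i) = x * (s * (p (.A (prev i)) - p .O) - (p (.A i) - p .O)) +
        y * (-l₁ * (p (.A i) - p .O)) := by
      rw [hB, hQ', AffineMap.lineMap_apply_module']
      simp only [Complex.real_smul]
      ring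
    rw [hz]
    unfold inFrame
    simp only [map_mul, Complex.conj_conj]
    linear_combination conj (p (.A i) - p .O) * h3 + (1 - x - y * l₁) * hu
  have hwr := congrArg Complex.re hw
  have hwi := congrArg Complex.im hw
  simp only [Complex.sub_re, Complex.sub_im, Complex.add_re, Complex.add_im, Complex.mul_re,
    Complex.mul_im, Complex.ofReal_re, Complex.ofReal_im, Complex.conj_re, Complex.conj_im,
    Complex.one_re, Complex.one_im, Complex.neg_re, Complex.neg_im] at hwr hwi
  have nAB := norm_inFrame_sub hp i (.B i) (.A i)
  rw [norm_AB hp, inFrame_A hp] at nAB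
  have nAB' := Complex.sq_norm (inFrame p i (.B i) - 1)
  rw [nAB, Complex.normSq_apply] at nAB'
  simp only [Complex.sub_re, Complex.sub_im, Complex.one_re, Complex.one_im] at nAB'
  obtain ⟨b1, b2, b3⟩ := of_mem_arc (u := (inFrame p i (.B i)).re)
    (h := -(inFrame p i (.B i)).im) hc.l₁_pos hc.l₁_lt hCS h0 h1 h2
    hs.symm hsC (by linarith) hx hy (by linarith) (by linarith)
  obtain ⟨hR1, hR0⟩ := eq_of_isFoot (norm_OA hp _) hR
  obtain ⟨hS1, hS0⟩ := eq_of_isFoot (norm_OA hp _) hS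
  have eB := inFrame_mul_petalRot hp i (.B i)
  have eC := inFrame_mul_petalRot hp i (.C i)
  change R - p .O = (inFrame p (prev i) (.B i)).re * _ at hR1
  change 0 ≤ (inFrame p (prev i) (.B i)).re at hR0
  change S - p .O = (inFrame p i (.B i)).re * _ at hS1
  change 0 ≤ (inFrame p i (.B i)).re at hS0
  rw [← eB] at hR1 hR0
  have a0 := arm_mul_conj hp i
  have a0' := arm_mul_conj hp (prev i)
  have ne : ∀ j, conj (p (.A j) - p .O) ≠ 0 := fun j h => by
    have := arm_mul_conj hp j
    rw [h, mul_zero] at this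
    exact zero_ne_one this
  set r := (inFrame p i (.B i) * petalRot p i).re with hr
  set u := (inFrame p i (.B i)).re with hu
  have r' : r = u * (petalRot p i).re - (inFrame p i (.B i)).im * (petalRot p i).im := by
    rw [hr, Complex.mul_re]
  -- the coordinates of the corners in the two frames
  have R1 : (R - p .O) * conj (p (.A (prev i)) - p .O) = r := by
    rw [hR1]; linear_combination (r : ℂ) * a0'
  have R2 : (R - p .O) * conj (p (.A i) - p .O) = r * conj (petalRot p i) := by
    rw [hR1, hz]; simp only [map_mul, Complex.conj_conj]; ring
  have S1 : (S - p .O) * conj (p (.A (prev i)) - p .O) = u * petalRot p i := by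
    rw [hS1, hz]; ring
  have S2 : (S - p .O) * conj (p (.A i) - p .O) = u := by
    rw [hS1]; linear_combination (u : ℂ) * a0
  have B1 : (p (.B i) - p .O) * conj (p (.A (prev i)) - p .O) =
      inFrame p i (.B i) * petalRot p i := eB.symm
  have B2 : (p (.B i) - p .O) * conj (p (.A i) - p .O) = inFrame p i (.B i) := rfl
  have C1 : (p (.C i) - p .O) * conj (p (.A (prev i)) - p .O) =
      inFrame p i (.C i) * petalRot p i := eC.symm
  have C2 : (p (.C i) - p .O) * conj (p (.A i) - p .O) = inFrame p i (.C i) := rfl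
  -- One half-plane for each side. A factor `±I` in `q` selects the distance from an arm (`t = 0`);
  -- a factor `-1`, the distance from the perpendicular through `B`.
  have c1 := pos_of_mem_interior_convexHull (o := p .O)
    (q := conj (p (.A (prev i)) - p .O) * -Complex.I) (t := 0) (mul_ne_zero (ne _) (by simp))
    ?_ hC
  have c2 := pos_of_mem_interior_convexHull (o := p .O)
    (q := conj (p (.A i) - p .O) * Complex.I) (t := 0) (mul_ne_zero (ne _) (by simp)) ?_ hC
  have c3 := pos_of_mem_interior_convexHull (o := p .O)
    (q := conj (p (.A (prev i)) - p .O) * -1) (t := r) (mul_ne_zero (ne _) (by simp)) ?_ hC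
  have c4 := pos_of_mem_interior_convexHull (o := p .O)
    (q := conj (p (.A i) - p .O) * -1) (t := u) (mul_ne_zero (ne _) (by simp)) ?_ hC
  · revert k
    simp only [slack, Fin.forall_fin_succ, Fin.isValue, Matrix.cons_val_zero,
      Matrix.cons_val_succ, IsEmpty.forall_iff, and_true]
    rw [← mul_assoc, C1] at c1 c3
    rw [← mul_assoc, C2] at c2 c4
    simp only [Complex.mul_re, Complex.mul_im, Complex.neg_re, Complex.neg_im, Complex.I_re,
      Complex.I_im, Complex.one_re, Complex.one_im, Complex.sub_re, Complex.sub_im] at c1 c2 c3 c4 ⊢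
    refine ⟨h0, h1, ?_, ?_, ?_, ?_, ?_, ?_, ?_, ?_⟩ <;> linarith
  all_goals
    simp only [mem_insert_iff, mem_singleton_iff, forall_eq_or_imp, forall_eq, ← mul_assoc,
      sub_self, zero_mul, R1, R2, S1, S2, B1, B2]
    simp only [Complex.mul_re, Complex.mul_im, Complex.neg_re, Complex.neg_im, Complex.I_re,
      Complex.I_im, Complex.one_re, Complex.one_im, Complex.ofReal_re, Complex.ofReal_im,
      Complex.conj_re, Complex.conj_im, Complex.zero_re]
  all_goals
    have k1 := mul_nonneg hR0 h1.le
    have k2 := mul_nonneg hS0 h1.le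
    have k3 := mul_pos b1 h1
    have k4 := mul_pos b2 h1
    have k5 : u = u * ((petalRot p i).re ^ 2 + (petalRot p i).im ^ 2) := by rw [hCS, mul_one]
    have k6 : r * (petalRot p i).re = u * (petalRot p i).re ^ 2 -
        (inFrame p i (.B i)).im * (petalRot p i).im * (petalRot p i).re := by
      rw [r']
      ring
    refine ⟨?_, ?_, ?_, ?_⟩ <;> linarith

theorem IsLockedStart.isTrapped (hs : IsLockedStart l₁ p) : IsTrapped l₁ p := by
  have hn : 1 < n := by have := hc.n_gt; omega
  obtain ⟨hord, hang, hres⟩ := hs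
  have hpos : ∀ i, 0 < petalAngle p i := fun i => hc.alpha_pos.trans (hang i).1
  have hlt : ∀ i, petalAngle p i < π / 2 := fun i => (hang i).2.trans hc.beta_lt
  have hrot : ∀ i, petalRot p i = Complex.exp (petalAngle p i * Complex.I) := fun i => by
    obtain ⟨φ, hmono, hφlt, hφ⟩ := hord
    rw [petalAngle_of_ordered hn hmono hφlt hφ, petalRot, hφ, hφ, ← Complex.exp_conj,
      ← Complex.exp_add, Complex.exp_eq_exp_iff_exists_int]
    split_ifs with h
    · refine ⟨-1, ?_⟩
      simp
      ring
    · refine ⟨0, ?_⟩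
      simp
      ring
  have hre : ∀ i, (petalRot p i).re = cos (petalAngle p i) := fun i => by
    rw [hrot, Complex.exp_ofReal_mul_I_re]
  have him : ∀ i, (petalRot p i).im = sin (petalAngle p i) := fun i => by
    rw [hrot, Complex.exp_ofReal_mul_I_im]
  refine ⟨fun i => slack_pos_of_isRestricted hc hp ?_ ?_ ?_ (hres i), ?_⟩
  · rw [hre]
    exact cos_pos_of_mem_Ioo ⟨by linarith [hpos i, pi_pos], hlt i⟩
  · rw [him]
    exact sin_pos_of_pos_of_lt_pi (hpos i) (by linarith [hlt i, pi_pos])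
  · rw [him, ← hc.sin_beta]
    exact sin_lt_sin_of_lt_of_le_pi_div_two (by linarith [hpos i, pi_pos]) hc.beta_lt.le
      (hang i).2
  · have : angleSum p = 2 * π := by
      rw [← sum_petalAngle_of_ordered hn hord]
      refine Finset.sum_congr rfl fun i _ => ?_
      rw [him, arcsin_sin (by linarith [hpos i, pi_pos]) (hlt i).le]
    simp [this]

end Start

/-! ### The underlying tree and the list of link pairs -/

/-- The joints of the tree other than `O` correspond to its links. -/
def jointEquiv (n : ℕ) : Joint n ≃ Option (Fin n ⊕ Fin n ⊕ Fin n) where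
  toFun
    | .O => none
    | .A i => some (.inl i)
    | .B i => some (.inr (.inl i))
    | .C i => some (.inr (.inr i))
  invFun
    | none => .O
    | some (.inl i) => .A i
    | some (.inr (.inl i)) => .B i
    | some (.inr (.inr i)) => .C i
  left_inv v := by cases v <;> rfl
  right_inv v := by rcases v with _ | _ | _ | _ <;> rfl

instance (n : ℕ) : Finite (Joint n) := Finite.of_equiv _ (jointEquiv n).symm

/-- The link that leads to a given joint from the side of `O`. -/
def linkEdge {n : ℕ} : Fin n ⊕ Fin n ⊕ Fin n → Sym2 (Joint n)
  | .inl i => s(.O, .A i)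
  | .inr (.inl i) => s(.A i, .B i)
  | .inr (.inr i) => s(.B i, .C i)

theorem linkEdge_injective {n : ℕ} : Function.Injective (linkEdge (n := n)) := by
  rintro (i | i | i) (j | j | j) h <;> simp [linkEdge] at h ⊢ <;> exact h

section

variable {n : ℕ} {l₁ l₂ : ℝ} {h₁ : 0 < l₁} {h₂ : 0 < l₂}

theorem petalLinkage_edgeSet :
    (petalLinkage n l₁ l₂ h₁ h₂).graph.edgeSet = range (linkEdge (n := n)) := by
  ext e
  induction e with
  | _ u v =>
    rw [SimpleGraph.mem_edgeSet, petalLinkage_adj]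
    constructor
    · rintro (h | h) <;> cases h with
      | OA i => exact ⟨.inl i, by simp [linkEdge]⟩
      | AB i => exact ⟨.inr (.inl i), by simp [linkEdge]⟩
      | BC i => exact ⟨.inr (.inr i), by simp [linkEdge]⟩
    · have key : ∀ {x y : Joint n}, IsLink x y → s(x, y) = s(u, v) → IsLink u v ∨ IsLink v u := by
        intro x y h he
        rcases Sym2.eq_iff.1 he with ⟨rfl, rfl⟩ | ⟨rfl, rfl⟩
        exacts [Or.inl h, Or.inr h]
      rintro ⟨i | i | i, h⟩
      exacts [key (.OA i) h, key (.AB i) h, key (.BC i) h]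

theorem petalLinkage_isTree : (petalLinkage n l₁ l₂ h₁ h₂).graph.IsTree := by
  rw [SimpleGraph.isTree_iff_connected_and_card]
  constructor
  · have hA : ∀ i, (petalLinkage n l₁ l₂ h₁ h₂).graph.Reachable .O (.A i) := fun i =>
      (adj_of_isLink (.OA i)).reachable
    have hB : ∀ i, (petalLinkage n l₁ l₂ h₁ h₂).graph.Reachable .O (.B i) := fun i =>
      (hA i).trans (adj_of_isLink (.AB i)).reachable
    have hC : ∀ i, (petalLinkage n l₁ l₂ h₁ h₂).graph.Reachable .O (.C i) := fun i =>
      (hB i).trans (adj_of_isLink (.BC i)).reachable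
    have h : ∀ v, (petalLinkage n l₁ l₂ h₁ h₂).graph.Reachable .O v := by
      rintro (_ | i | i | i)
      exacts [SimpleGraph.Reachable.refl _, hA i, hB i, hC i]
    exact { preconnected := fun u v => (h u).symm.trans (h v), nonempty := ⟨.O⟩ }
  · rw [petalLinkage_edgeSet, ← Nat.card_congr (Equiv.ofInjective _ linkEdge_injective),
      Nat.card_congr (jointEquiv n), Finite.card_option]

theorem isConfiguration_of_links {p : Joint n → ℂ} (hA : ∀ i, dist (p .O) (p (.A i)) = 1)
    (hB : ∀ i, dist (p (.A i)) (p (.B i)) = l₁) (hC : ∀ i, dist (p (.B i)) (p (.C i)) = l₂)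
    (hO : ∀ i j, i ≠ j →
      segment ℝ (p .O) (p (.A i)) ∩ segment ℝ (p .O) (p (.A j)) = {p .O})
    (hOB : ∀ i, segment ℝ (p (.A i)) (p .O) ∩ segment ℝ (p (.A i)) (p (.B i)) = {p (.A i)})
    (hAC : ∀ i, segment ℝ (p (.B i)) (p (.A i)) ∩ segment ℝ (p (.B i)) (p (.C i)) = {p (.B i)})
    (hOA_AB : ∀ i j, i ≠ j →
      Disjoint (segment ℝ (p .O) (p (.A i))) (segment ℝ (p (.A j)) (p (.B j))))
    (hOA_BC : ∀ i j, Disjoint (segment ℝ (p .O) (p (.A i))) (segment ℝ (p (.B j)) (p (.C j))))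
    (hAB_AB : ∀ i j, i ≠ j →
      Disjoint (segment ℝ (p (.A i)) (p (.B i))) (segment ℝ (p (.A j)) (p (.B j))))
    (hAB_BC : ∀ i j, i ≠ j →
      Disjoint (segment ℝ (p (.A i)) (p (.B i))) (segment ℝ (p (.B j)) (p (.C j))))
    (hBC_BC : ∀ i j, i ≠ j →
      Disjoint (segment ℝ (p (.B i)) (p (.C i))) (segment ℝ (p (.B j)) (p (.C j)))) :
    (petalLinkage n l₁ l₂ h₁ h₂).IsConfiguration p where
  dist_eq u v h := by
    have key : ∀ {x y : Joint n}, IsLink x y → dist (p x) (p y) = linkLength l₁ l₂ x y := by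
      rintro _ _ (i | i | i)
      · exact hA i
      · simpa [linkLength] using hB i
      · simpa [linkLength] using hC i
    rcases petalLinkage_adj.1 h with h | h
    · exact key h
    · rw [dist_comm, key h]
      exact linkLength_symm _ _ _ _
  inter_eq u v w huv huw hvw := by
    rw [petalLinkage_adj] at huv huw
    rcases huv with h | h <;> rcases huw with h' | h' <;> cases h <;> cases h' <;>
      first
      | exact absurd rfl hvw
      | exact hO _ _ (by rintro rfl; exact hvw rfl)
      | exact hOB _
      | exact hAC _
      | exact (inter_comm _ _).trans (hOB _)
      | exact (inter_comm _ _).trans (hAC _)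
  disjoint u v w x huv hwx h1 h2 h3 h4 := by
    have key : ∀ {u v w x : Joint n}, IsLink u v → IsLink w x → u ≠ w → u ≠ x → v ≠ w → v ≠ x →
        Disjoint (segment ℝ (p u) (p v)) (segment ℝ (p w) (p x)) := by
      rintro _ _ _ _ (i | i | i) (j | j | j) h1 h2 h3 h4
      · exact absurd rfl h1
      · exact hOA_AB i j (by rintro rfl; exact h3 rfl)
      · exact hOA_BC i j
      · exact (hOA_AB j i (by rintro rfl; exact h2 rfl)).symm
      · exact hAB_AB i j (by rintro rfl; exact h1 rfl)
      · exact hAB_BC i j (by rintro rfl; exact h3 rfl)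
      · exact (hOA_BC j i).symm
      · exact (hAB_BC j i (by rintro rfl; exact h2 rfl)).symm
      · exact hBC_BC i j (by rintro rfl; exact h1 rfl)
    rcases petalLinkage_adj.1 huv with h | h <;> rcases petalLinkage_adj.1 hwx with h' | h'
    · exact key h h' h1 h2 h3 h4
    · rw [segment_symm ℝ (p w)]
      exact key h h' h2 h1 h4 h3
    · rw [segment_symm ℝ (p u)]
      exact key h h' h3 h4 h1 h2
    · rw [segment_symm ℝ (p u), segment_symm ℝ (p w)]
      exact key h h' h4 h3 h2 h1

end

/-! ### Configurations made of rotated copies of one chain -/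

/-- The placement whose petals are the chain `0, 1, b, c`, rotated by the multiples of `η`. -/
noncomputable def rotatedPlacement (n : ℕ) (η : ℝ) (b c : ℂ) : Joint n → ℂ
  | .O => 0
  | .A i => Complex.exp ((η * (i.val : ℝ) : ℝ) * Complex.I)
  | .B i => b * Complex.exp ((η * (i.val : ℝ) : ℝ) * Complex.I)
  | .C i => c * Complex.exp ((η * (i.val : ℝ) : ℝ) * Complex.I)

/-- The sector of the angles from `-ψ` to `0`. -/
def sector (ψ : ℝ) : Set ℂ :=
  {w | 0 ≤ w.re ∧ w.im ≤ 0 ∧ -w.im * cos ψ ≤ w.re * sin ψ}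

theorem convex_sector (ψ : ℝ) : Convex ℝ (sector ψ) := by
  rintro x ⟨hx1, hx2, hx3⟩ y ⟨hy1, hy2, hy3⟩ a b ha hb hab
  simp only [sector, mem_ofPred_eq, Complex.add_re, Complex.add_im, Complex.real_smul,
    Complex.re_ofReal_mul, Complex.im_ofReal_mul]
  have e1 := mul_nonneg ha hx1
  have e2 := mul_nonneg hb hy1
  have e3 := mul_nonpos_of_nonneg_of_nonpos ha hx2
  have e4 := mul_nonpos_of_nonneg_of_nonpos hb hy2
  have e5 := mul_le_mul_of_nonneg_left hx3 ha
  have e6 := mul_le_mul_of_nonneg_left hy3 hb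
  refine ⟨by linarith, by linarith, by linarith⟩

theorem exists_polar_of_mem_sector {ψ : ℝ} (h0 : 0 ≤ ψ) {w : ℂ}
    (hw : w ∈ sector ψ) (hne : w ≠ 0) :
    ∃ ρ > 0, ∃ χ, 0 ≤ χ ∧ χ ≤ ψ ∧ w = (ρ : ℝ) * Complex.exp ((-χ : ℝ) * Complex.I) := by
  obtain ⟨hre, him, hs⟩ := hw
  have hn : 0 < ‖w‖ := norm_pos_iff.2 hne
  refine ⟨‖w‖, hn, -w.arg, ?_, ?_, ?_⟩
  · rcases him.lt_or_eq with h | h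
    · exact (neg_pos.2 (Complex.arg_neg_iff.2 h)).le
    · rw [Complex.arg_eq_zero_iff.2 ⟨hre, h⟩, neg_zero]
  · by_contra! hlt
    have h2 := Complex.abs_arg_le_pi_div_two_iff.2 hre
    have h3 : 0 < sin (-w.arg - ψ) :=
      sin_pos_of_pos_of_lt_pi (by linarith) (by linarith [abs_le.1 h2, pi_pos])
    rw [sin_sub, sin_neg, cos_neg] at h3
    have h4 := mul_pos hn h3
    rw [mul_sub, ← mul_assoc, ← mul_assoc, mul_neg, Complex.norm_mul_sin_arg,
      Complex.norm_mul_cos_arg] at h4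
    linarith
  · rw [neg_neg]
    exact (Complex.norm_mul_exp_arg_mul_I w).symm

theorem mem_segment_mul_right {x y e w : ℂ} (h : w ∈ segment ℝ (x * e) (y * e)) :
    ∃ v ∈ segment ℝ x y, w = v * e := by
  obtain ⟨a, b, ha, hb, hab, rfl⟩ := h
  refine ⟨a • x + b • y, ⟨a, b, ha, hb, hab, rfl⟩, ?_⟩
  simp only [Complex.real_smul]
  ring

theorem mem_segment_mul_right_iff {x y e v : ℂ} (he : e ≠ 0) :
    v * e ∈ segment ℝ (x * e) (y * e) ↔ v ∈ segment ℝ x y := by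
  constructor
  · intro h
    obtain ⟨v', hv', h'⟩ := mem_segment_mul_right h
    rwa [mul_right_cancel₀ he h']
  · rintro ⟨a, b, ha, hb, hab, rfl⟩
    refine ⟨a, b, ha, hb, hab, ?_⟩
    simp only [Complex.real_smul]
    ring

theorem inter_segment_mul_right {x y z e : ℂ} (he : e ≠ 0)
    (h : segment ℝ x y ∩ segment ℝ x z = {x}) :
    segment ℝ (x * e) (y * e) ∩ segment ℝ (x * e) (z * e) = {x * e} := by
  refine Subset.antisymm ?_ (singleton_subset_iff.2 ⟨left_mem_segment _ _ _, left_mem_segment _ _ _⟩)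
  rintro w ⟨hw1, hw2⟩
  obtain ⟨v, hv, rfl⟩ := mem_segment_mul_right hw1
  have h1 : v ∈ segment ℝ x y ∩ segment ℝ x z := ⟨hv, (mem_segment_mul_right_iff he).1 hw2⟩
  rw [h, mem_singleton_iff] at h1
  rw [h1, mem_singleton_iff]

theorem disjoint_segment_mul_right {x y z t e : ℂ} (he : e ≠ 0)
    (h : Disjoint (segment ℝ x y) (segment ℝ z t)) :
    Disjoint (segment ℝ (x * e) (y * e)) (segment ℝ (z * e) (t * e)) := by
  refine Set.disjoint_left.2 fun w hw1 hw2 => ?_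
  obtain ⟨v, hv, rfl⟩ := mem_segment_mul_right hw1
  exact Set.disjoint_left.1 h hv ((mem_segment_mul_right_iff he).1 hw2)

section Rotated

variable {n : ℕ} {η ψ : ℝ}

/-- Rotated copies of a sector meet only at the origin. -/
theorem eq_zero_of_rotated_sector (h0 : 0 ≤ ψ) (hη : ψ < η)
    (hη' : ((n : ℝ) - 1) * η < 2 * π - ψ) {i j : Fin n} (hij : i ≠ j) {v w : ℂ}
    (hv : v ∈ sector ψ) (hw : w ∈ sector ψ)
    (h : v * Complex.exp ((η * (i.val : ℝ) : ℝ) * Complex.I) =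
      w * Complex.exp ((η * (j.val : ℝ) : ℝ) * Complex.I)) : v = 0 := by
  by_contra hv0
  have hw0 : w ≠ 0 := by
    rintro rfl
    rw [zero_mul] at h
    exact mul_ne_zero hv0 (Complex.exp_ne_zero _) h
  wlog hlt : j < i generalizing i j v w
  · exact this hij.symm hw hv h.symm hw0 hv0 (lt_of_le_of_ne (not_lt.1 hlt) hij)
  obtain ⟨ρ, hρ, χ, hχ, hχ', rfl⟩ := exists_polar_of_mem_sector h0 hv hv0
  obtain ⟨ρ', hρ', χ', hx, hx', rfl⟩ := exists_polar_of_mem_sector h0 hw hw0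
  have hnorm := congrArg norm h
  simp only [norm_mul, Complex.norm_exp_ofReal_mul_I, Complex.norm_real, mul_one,
    Real.norm_of_nonneg hρ.le, Real.norm_of_nonneg hρ'.le] at hnorm
  rw [hnorm, mul_assoc, mul_assoc] at h
  have h' := mul_left_cancel₀ (Complex.ofReal_ne_zero.2 hρ'.ne') h
  rw [← Complex.exp_add, ← Complex.exp_add, Complex.exp_eq_exp_iff_exists_int] at h'
  obtain ⟨k, hk⟩ := h'
  have hk' := congrArg Complex.im hk
  simp at hk'
  have hi : (i.val : ℝ) + 1 ≤ n := by exact_mod_cast i.isLt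
  have hji : (j.val : ℝ) + 1 ≤ i.val := by exact_mod_cast hlt
  have hj : (0 : ℝ) ≤ j.val := Nat.cast_nonneg _
  have hηpos : 0 < η := h0.trans_lt hη
  -- The directions differ by `(i - j) η` up to an error of at most `ψ`. This lies strictly between
  -- 0 and `2π`, so it is no multiple of `2π`.
  have e1 : 1 * η ≤ ((i.val : ℝ) - j.val) * η :=
    mul_le_mul_of_nonneg_right (by linarith) hηpos.le
  have e2 : ((i.val : ℝ) - j.val) * η ≤ ((n : ℝ) - 1) * η :=
    mul_le_mul_of_nonneg_right (by linarith) hηpos.le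
  have k1 : 0 < (k : ℝ) * (2 * π) := by linarith
  have k2 : (k : ℝ) * (2 * π) < 1 * (2 * π) := by linarith
  have k3 : (0 : ℝ) < k := pos_of_mul_pos_left k1 two_pi_pos.le
  have k4 : (k : ℝ) < 1 := lt_of_mul_lt_mul_right k2 two_pi_pos.le
  have k5 : 0 < k := by exact_mod_cast k3
  have k6 : k < 1 := by exact_mod_cast k4
  omega

/-- Different petals can meet only at the origin, which only the arms `OA` contain; so it suffices
to check one chain. -/
theorem isConfiguration_rotatedPlacement {l₁ l₂ : ℝ} {h₁ : 0 < l₁} {h₂ : 0 < l₂} {b c : ℂ}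
    (h0 : 0 ≤ ψ) (h1 : ψ < π / 2) (hη : ψ < η) (hη' : ((n : ℝ) - 1) * η < 2 * π - ψ)
    (hAB : dist 1 b = l₁) (hBC : dist b c = l₂) (hb : b ∈ sector ψ) (hc : c ∈ sector ψ)
    (hb0 : 0 ∉ segment ℝ 1 b) (hA : segment ℝ 1 0 ∩ segment ℝ 1 b = {1})
    (hB : segment ℝ b 1 ∩ segment ℝ b c = {b})
    (hOC : Disjoint (segment ℝ 0 1) (segment ℝ b c)) :
    (petalLinkage n l₁ l₂ h₁ h₂).IsConfiguration (rotatedPlacement n η b c) := by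
  set e : Fin n → ℂ := fun i => Complex.exp ((η * (i.val : ℝ) : ℝ) * Complex.I) with he
  have hne : ∀ i, e i ≠ 0 := fun i => Complex.exp_ne_zero _
  have hnorm : ∀ i, ‖e i‖ = 1 := fun i => Complex.norm_exp_ofReal_mul_I _
  have pO : rotatedPlacement n η b c .O = 0 := rfl
  have pA : ∀ i, rotatedPlacement n η b c (.A i) = 1 * e i := fun i => (one_mul _).symm
  have pB : ∀ i, rotatedPlacement n η b c (.B i) = b * e i := fun i => rfl
  have pC : ∀ i, rotatedPlacement n η b c (.C i) = c * e i := fun i => rfl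
  have hdist : ∀ i (x y : ℂ), dist (x * e i) (y * e i) = dist x y := fun i x y => by
    rw [dist_eq_norm, ← sub_mul, norm_mul, hnorm, mul_one, dist_eq_norm]
  have hc0 : 0 ∉ segment ℝ b c := fun h =>
    Set.disjoint_left.1 hOC (left_mem_segment _ _ _) h
  have m0 : (0 : ℂ) ∈ sector ψ := by simp [sector]
  have hsin : 0 ≤ sin ψ := sin_nonneg_of_nonneg_of_le_pi h0 (by linarith [pi_pos])
  have m1 : (1 : ℂ) ∈ sector ψ := by simp [sector, hsin]
  have hdisj : ∀ {i j : Fin n} {x y z t : ℂ}, i ≠ j → x ∈ sector ψ → y ∈ sector ψ →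
      z ∈ sector ψ → t ∈ sector ψ → 0 ∉ segment ℝ z t →
      Disjoint (segment ℝ (x * e i) (y * e i)) (segment ℝ (z * e j) (t * e j)) := by
    intro i j x y z t hij hx hy hz ht hzt
    refine Set.disjoint_left.2 fun w hw hw' => ?_
    obtain ⟨v, hv, rfl⟩ := mem_segment_mul_right hw
    obtain ⟨v', hv', h⟩ := mem_segment_mul_right hw'
    have := eq_zero_of_rotated_sector h0 hη hη' hij.symm
      ((convex_sector ψ).segment_subset hz ht hv') ((convex_sector ψ).segment_subset hx hy hv)
      h.symm
    exact hzt (this ▸ hv')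
  have pO' : ∀ i, rotatedPlacement n η b c .O = 0 * e i := fun i => by rw [pO, zero_mul]
  refine isConfiguration_of_links ?_ ?_ ?_ ?_ ?_ ?_ ?_ ?_ ?_ ?_ ?_
  · intro i
    rw [pO, pA, one_mul, dist_zero_left, hnorm]
  · intro i
    rw [pA, pB, hdist, hAB]
  · intro i
    rw [pB, pC, hdist, hBC]
  · intro i j hij
    refine Subset.antisymm ?_
      (singleton_subset_iff.2 ⟨left_mem_segment _ _ _, left_mem_segment _ _ _⟩)
    rintro w ⟨hw, hw'⟩
    rw [pA, pO' i] at hw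
    rw [pA, pO' j] at hw'
    obtain ⟨v, hv, rfl⟩ := mem_segment_mul_right hw
    obtain ⟨v', hv', h⟩ := mem_segment_mul_right hw'
    have := eq_zero_of_rotated_sector h0 hη hη' hij
      ((convex_sector ψ).segment_subset m0 m1 hv) ((convex_sector ψ).segment_subset m0 m1 hv') h
    rw [this, zero_mul, pO, mem_singleton_iff]
  · intro i
    rw [pA, pB, pO' i]
    exact inter_segment_mul_right (hne i) hA
  · intro i
    rw [pA, pB, pC]
    exact inter_segment_mul_right (hne i) hB
  · intro i j hij
    rw [pA, pA, pB, pO' i]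
    exact hdisj hij m0 m1 m1 hb hb0
  · intro i j
    rw [pA, pB, pC, pO' i]
    by_cases hij : i = j
    · subst hij
      exact disjoint_segment_mul_right (hne i) hOC
    · exact hdisj hij m0 m1 hb hc hc0
  · intro i j hij
    rw [pA, pA, pB, pB]
    exact hdisj hij m1 hb m1 hb hb0
  · intro i j hij
    rw [pA, pB, pB, pC]
    exact hdisj hij m1 hb hb hc hc0
  · intro i j hij
    rw [pB, pB, pC, pC]
    exact hdisj hij hb hc hb hc hc0

theorem isCcwOrdered_rotatedPlacement (b c : ℂ) (h0 : 0 < η) (h : ((n : ℝ) - 1) * η < 2 * π) :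
    IsCcwOrdered (rotatedPlacement n η b c) := by
  refine ⟨fun i => η * (i.val : ℝ), fun i j hij => ?_, fun i j => ?_, fun i => sub_zero _⟩
  · have : (i.val : ℝ) < j.val := by exact_mod_cast hij
    exact mul_lt_mul_of_pos_left this h0
  · have hj : (j.val : ℝ) + 1 ≤ n := by exact_mod_cast j.isLt
    have hi : 0 ≤ η * (i.val : ℝ) := by positivity
    have : (j.val : ℝ) * η ≤ ((n : ℝ) - 1) * η := by gcongr; linarith
    linarith

theorem petalAngle_rotatedPlacement (b c : ℂ) (hn : 1 < n) (h0 : 0 < η)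
    (h : ((n : ℝ) - 1) * η < 2 * π) (i : Fin n) :
    petalAngle (rotatedPlacement n η b c) i =
      if i.val = 0 then 2 * π - ((n : ℝ) - 1) * η else η := by
  have hv := val_prev i
  refine ccwAngle_eq (by simp [rotatedPlacement]) ?_ ?_ ?_
  · split_ifs <;> linarith
  · have hn' : (2 : ℝ) ≤ n := by exact_mod_cast hn
    have : 1 * η ≤ ((n : ℝ) - 1) * η := by gcongr; linarith
    split_ifs <;> linarith
  · simp only [rotatedPlacement, sub_zero]
    rw [← Complex.exp_add, Complex.exp_eq_exp_iff_exists_int]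
    split_ifs at hv ⊢ with hi
    · refine ⟨-1, ?_⟩
      rw [hv, hi, Nat.cast_sub hn.le]
      push_cast
      ring
    · refine ⟨0, ?_⟩
      rw [hv, Nat.cast_sub (by omega)]
      push_cast
      ring

end Rotated

/-! ### The configuration with a small petal angle -/

/-- Straight chains pointing away from `O` fit into the degenerate sector `ψ = 0`, so any small
spacing works; `α / 2` is used. Petal 0 takes up the rest of the full turn, hence petal 1 is the
witness. -/
theorem exists_radial_configuration {n : ℕ} {l₁ l₂ : ℝ} (hc : Constraints n l₁ l₂) :
    ∃ q : Joint n → ℂ, (petalLinkage n l₁ l₂ hc.l₁_pos hc.l₂_pos).IsConfiguration q ∧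
      IsCcwOrdered q ∧ ∃ i, petalAngle q i < alpha n l₁ := by
  have hn : 1 < n := by have := hc.n_gt; omega
  have hα := hc.alpha_pos
  have hl₁ := hc.l₁_pos
  have hl₂ := hc.l₂_pos
  have hη : ((n : ℝ) - 1) * (alpha n l₁ / 2) < 2 * π := by
    linarith [hc.sub_one_mul_alpha, hc.beta_pos, pi_pos]
  refine ⟨rotatedPlacement n (alpha n l₁ / 2) (1 + l₁ : ℝ) (1 + l₁ + l₂ : ℝ),
    isConfiguration_rotatedPlacement (ψ := 0) le_rfl (by positivity) (by positivity)
      (by linarith) ?_ ?_ ?_ ?_ ?_ ?_ ?_ ?_,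
    isCcwOrdered_rotatedPlacement _ _ (by positivity) hη, ⟨1, hn⟩, ?_⟩
  · rw [dist_comm, Complex.dist_eq, ← Complex.ofReal_one, ← Complex.ofReal_sub, Complex.norm_real,
      add_sub_cancel_left, Real.norm_of_nonneg hl₁.le]
  · rw [dist_comm, Complex.dist_eq, ← Complex.ofReal_sub, Complex.norm_real,
      add_sub_cancel_left, Real.norm_of_nonneg hl₂.le]
  · simp only [sector, mem_ofPred_eq, Complex.ofReal_re, Complex.ofReal_im, sin_zero, cos_zero]
    exact ⟨by positivity, le_rfl, by simp⟩
  · simp only [sector, mem_ofPred_eq, Complex.ofReal_re, Complex.ofReal_im, sin_zero, cos_zero]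
    exact ⟨by positivity, le_rfl, by simp⟩
  · rintro ⟨a, b, ha, hb, hab, h⟩
    have h' := congrArg Complex.re h
    simp at h'
    nlinarith
  · refine Subset.antisymm ?_
      (singleton_subset_iff.2 ⟨left_mem_segment _ _ _, left_mem_segment _ _ _⟩)
    rintro w ⟨⟨a, b, ha, hb, hab, h⟩, ⟨a', b', ha', hb', hab', h'⟩⟩
    have e1 := congrArg Complex.re h
    have e2 := congrArg Complex.re h'
    have e3 := congrArg Complex.im h
    simp at e1 e2 e3
    have : w.re = 1 := by nlinarith
    exact Complex.ext this e3.symm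
  · refine Subset.antisymm ?_
      (singleton_subset_iff.2 ⟨left_mem_segment _ _ _, left_mem_segment _ _ _⟩)
    rintro w ⟨⟨a, b, ha, hb, hab, h⟩, ⟨a', b', ha', hb', hab', h'⟩⟩
    have e1 := congrArg Complex.re h
    have e2 := congrArg Complex.re h'
    have e3 := congrArg Complex.im h
    simp at e1 e2 e3
    have : w.re = 1 + l₁ := by nlinarith
    exact Complex.ext (by simpa using this) (by simpa using e3.symm)
  · refine Set.disjoint_left.2 ?_
    rintro w ⟨a, b, ha, hb, hab, h⟩ ⟨a', b', ha', hb', hab', h'⟩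
    have e1 := congrArg Complex.re h
    have e2 := congrArg Complex.re h'
    simp at e1 e2
    nlinarith
  · rw [petalAngle_rotatedPlacement _ _ hn (by positivity) hη, if_neg (by simp)]
    linarith

/-! ### Existence of a start -/

open ComplexConjugate

theorem mem_convexHull_triangle {e b w : ℂ} (he : ‖e‖ = 1) (hp : 0 < (b * conj e).re)
    (hq : (b * conj e).im ≠ 0) (h0 : 0 ≤ (w * conj e).im / (b * conj e).im)
    (h1 : (w * conj e).im / (b * conj e).im ≤ (w * conj e).re / (b * conj e).re)
    (h2 : (w * conj e).re ≤ (b * conj e).re) :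
    w ∈ convexHull ℝ {0, b, ((b * conj e).re : ℂ) * e} := by
  have hu : e * conj e = 1 := by
    rw [Complex.mul_conj, Complex.normSq_eq_norm_sq, he]
    simp
  set p := (b * conj e).re with hp'
  set q := (b * conj e).im with hq'
  set X := (w * conj e).re with hX'
  set Y := (w * conj e).im with hY'
  have hb : b = (p + q * Complex.I) * e := by
    rw [hp', hq', Complex.re_add_im]
    linear_combination -b * hu
  have hw : w = (X + Y * Complex.I) * e := by
    rw [hX', hY', Complex.re_add_im]
    linear_combination -w * hu
  have hXp : X / p ≤ 1 := (div_le_one hp).2 h2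
  have hp0 : (p : ℂ) ≠ 0 := Complex.ofReal_ne_zero.2 hp.ne'
  have hq0 : (q : ℂ) ≠ 0 := Complex.ofReal_ne_zero.2 hq
  -- The weights are the barycentric coordinates of `w` in the right triangle formed by `0`, `b` and
  -- the foot of `b` on the line of `e`.
  have key := (convex_convexHull ℝ {0, b, (p : ℂ) * e}).sum_mem (t := Finset.univ)
    (w := ![1 - X / p, Y / q, X / p - Y / q]) (z := ![0, b, (p : ℂ) * e]) ?_ ?_ ?_
  · rw [Fin.sum_univ_three] at key
    convert key using 1
    simp only [Matrix.cons_val_zero, Matrix.cons_val_one, Matrix.cons_val, Complex.real_smul]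
    push_cast
    generalize hB : b = b' at *
    rw [hw, hb]
    field_simp
    ring
  · intro i _
    fin_cases i
    · simpa using hXp
    · simpa using h0
    · simpa using h1
  · rw [Fin.sum_univ_three]
    simp
  · intro i _
    refine subset_convexHull ℝ _ ?_
    fin_cases i <;> simp

/-- The open diagonal from the apex of a quadrilateral with two right angles is interior. -/
theorem mul_mem_interior_quadrilateral {a a' b : ℂ} {τ : ℝ} (ha : ‖a‖ = 1) (ha' : ‖a'‖ = 1)
    (h1 : 0 < (b * conj a).re) (h2 : (b * conj a).im < 0) (h3 : 0 < (b * conj a').re)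
    (h4 : 0 < (b * conj a').im) (hτ : 0 < τ) (hτ' : τ < 1) :
    (τ : ℂ) * b ∈ interior (convexHull ℝ
      {0, ((b * conj a').re : ℂ) * a', b, ((b * conj a).re : ℂ) * a}) := by
  refine mem_interior.2 ⟨{w | (w * conj a).im < 0 ∧ 0 < (w * conj a').im ∧
    (w * conj a).re < (b * conj a).re ∧ (w * conj a').re < (b * conj a').re}, ?_, ?_, ?_⟩
  · rintro w ⟨w1, w2, w3, w4⟩
    have hid : ∀ {e : ℂ}, ‖e‖ = 1 → (w * conj e).im * (b * conj e).re -
        (w * conj e).re * (b * conj e).im = (w * conj b).im := fun {e} he => by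
      have := Complex.sq_norm e
      rw [he, Complex.normSq_apply] at this
      simp only [Complex.mul_re, Complex.mul_im, Complex.conj_re, Complex.conj_im]
      linear_combination (w.re * b.im - w.im * b.re) * this
    -- The diagonal through `b` cuts the quadrilateral into two right triangles; the sign tells
    -- which one contains `w`.
    rcases le_total 0 (w * conj b).im with h | h
    · refine convexHull_mono ?_ (mem_convexHull_triangle (w := w) ha h1 h2.ne
        (div_nonneg_of_nonpos w1.le h2.le) ?_ w3.le)
      · intro x hx
        simp only [mem_insert_iff, mem_singleton_iff] at hx ⊢
        tauto
      · rw [← hid ha] at h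
        rw [le_div_iff₀ h1, div_mul_eq_mul_div, div_le_iff_of_neg h2]
        linarith
    · refine convexHull_mono ?_ (mem_convexHull_triangle (w := w) ha' h3 h4.ne'
        (by positivity) ?_ w4.le)
      · intro x hx
        simp only [mem_insert_iff, mem_singleton_iff] at hx ⊢
        tauto
      · rw [← hid ha'] at h
        rw [div_le_div_iff₀ h4 h3]
        linarith
  · simp only [ofPred_and]
    refine IsOpen.inter (isOpen_lt ?_ ?_) (IsOpen.inter (isOpen_lt ?_ ?_)
      (IsOpen.inter (isOpen_lt ?_ ?_) (isOpen_lt ?_ ?_))) <;> fun_prop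
  · simp only [mem_ofPred_eq, mul_assoc, Complex.re_ofReal_mul, Complex.im_ofReal_mul]
    exact ⟨mul_neg_of_pos_of_neg hτ h2, mul_pos hτ h4, mul_lt_of_lt_one_left h1 hτ',
      mul_lt_of_lt_one_left h3 hτ'⟩

theorem isFoot_zero {A B : ℂ} (hA : ‖A‖ = 1) (h0 : 0 ≤ (B * conj A).re)
    (h1 : (B * conj A).re ≤ 1) : IsFoot B 0 A (((B * conj A).re : ℂ) * A) := by
  refine ⟨⟨1 - (B * conj A).re, (B * conj A).re, by linarith, h0, by ring, by simp⟩, ?_⟩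
  have h2 := Complex.sq_norm A
  rw [hA, Complex.normSq_apply] at h2
  rw [Complex.inner]
  simp only [Complex.sub_re, Complex.sub_im, Complex.mul_re, Complex.mul_im, Complex.ofReal_re,
    Complex.ofReal_im, Complex.conj_re, Complex.conj_im, Complex.zero_re, Complex.zero_im]
  linear_combination (B.re * A.re + B.im * A.im) * h2

namespace Constraints

variable {n : ℕ} {l₁ l₂ : ℝ} (hc : Constraints n l₁ l₂)
include hc

theorem n_pos : (0 : ℝ) < n := by linarith [hc.n_sub_one_pos]

theorem thetaBar_pos : 0 < thetaBar n := div_pos two_pi_pos hc.n_pos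

theorem mul_thetaBar : (n : ℝ) * thetaBar n = 2 * π := mul_div_cancel₀ _ hc.n_pos.ne'

theorem alpha_lt_thetaBar : alpha n l₁ < thetaBar n := by
  refine lt_of_mul_lt_mul_left ?_ hc.n_sub_one_pos.le
  linarith [hc.sub_one_mul_alpha, hc.mul_thetaBar, hc.thetaBar_lt]

/-- In the frame with `A = 1`, the joint `B = u - h i` of a restricted petal of angle `2π / n`
for which the joint `C` fits between `O` and `B`. -/
theorem exists_petal : ∃ u h s : ℝ, 0 < u ∧ 0 < h ∧ u < 1 ∧
    h * cos (thetaBar n) < u * sin (thetaBar n) ∧ (u - 1) ^ 2 + h ^ 2 = l₁ ^ 2 ∧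
    l₂ ^ 2 < u ^ 2 + h ^ 2 ∧ u ^ 2 + h ^ 2 < 1 ∧
    s ^ 2 - 2 * s * cos (thetaBar n) + 1 = l₁ ^ 2 ∧ s ≤ cos (thetaBar n) ∧ 0 < s ∧
    u < s * cos (thetaBar n) ∧ s * cos (thetaBar n) < 1 := by
  have hθ := hc.thetaBar_pos
  have hθβ := hc.thetaBar_lt
  have hβ := hc.beta_lt
  have hS : 0 < sin (thetaBar n) := sin_pos_of_pos_of_lt_pi hθ (by linarith [pi_pos])
  have hC : 0 < cos (thetaBar n) := cos_pos_of_mem_Ioo ⟨by linarith [pi_pos], by linarith⟩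
  have hSl : sin (thetaBar n) < l₁ := by
    rw [← hc.sin_beta]
    exact sin_lt_sin_of_lt_of_le_pi_div_two (by linarith [pi_pos]) hβ.le hθβ
  have hCS := sin_sq_add_cos_sq (thetaBar n)
  have hlP := hc.l₂_lt
  have hl := hc.one_lt
  have hl₂ := hc.l₂_pos
  unfold lP at hlP
  set C := cos (thetaBar n)
  set S := sin (thetaBar n)
  have hSl2 : S ^ 2 < l₁ ^ 2 := by gcongr
  set t := √(l₁ ^ 2 - S ^ 2)
  have ht : 0 ≤ t := Real.sqrt_nonneg _
  have ht2 : t ^ 2 = l₁ ^ 2 - S ^ 2 := Real.sq_sqrt (by linarith)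
  obtain ⟨s, hs⟩ : ∃ s, s = C - t := ⟨_, rfl⟩
  rw [← hs] at hlP
  have hsq : s ^ 2 - 2 * s * C + 1 = l₁ ^ 2 := by
    rw [hs]
    linear_combination ht2 - hCS
  have hsC : s ≤ C := by linarith
  have hs0 : 0 < s := by linarith
  have hC1 : C < 1 := by nlinarith
  -- Here `s = l_P(θ̄)` is `‖OP‖`, and `r` will be `‖OB‖`. It must exceed `l₂` to leave room for
  -- `C`, and stay below `s` to put `B` on the arc. Then `u` comes from the law of cosines in the
  -- triangle `OAB`.
  obtain ⟨r, hr1, hr2⟩ := exists_between hlP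
  have hr0 : 0 < r := by linarith
  have hrs : r ^ 2 < s ^ 2 := by gcongr
  set u := (r ^ 2 + 1 - l₁ ^ 2) / 2 with hu
  have hl1 : l₁ ^ 2 < 1 := by nlinarith [hc.l₁_pos, hc.l₁_lt]
  have hu0 : 0 < u := by
    have : 0 < r ^ 2 := by positivity
    linarith
  have hur : u < r := by
    have : (1 - r) ^ 2 < l₁ ^ 2 := by
      have : 0 ≤ 1 - r := by linarith
      gcongr
      linarith
    linarith
  have hur2 : u ^ 2 < r ^ 2 := by gcongr
  -- This puts `B` strictly inside the petal. It says that `ρ² - 2 C ρ + 1 - l₁²` is positive at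
  -- `r`, which lies below its smaller root `s`.
  have hrC : r * C < u := by
    have h1 : 0 < (s - r) * (2 * C - s - r) := mul_pos (by linarith) (by linarith)
    linarith
  have husC : u < s * C := by linarith
  have hh : 0 < √(r ^ 2 - u ^ 2) := Real.sqrt_pos.2 (by linarith)
  have hh2 : √(r ^ 2 - u ^ 2) ^ 2 = r ^ 2 - u ^ 2 := Real.sq_sqrt (by linarith)
  refine ⟨u, √(r ^ 2 - u ^ 2), s, hu0, hh, by linarith, ?_, ?_, ?_, ?_, hsq, hsC, hs0, husC, ?_⟩
  · refine lt_of_pow_lt_pow_left₀ 2 (by positivity) ?_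
    have h1 : (r * C) ^ 2 < u ^ 2 := by gcongr
    have h2 : S ^ 2 = 1 - C ^ 2 := by linarith
    rw [mul_pow, mul_pow, hh2, h2]
    linarith
  · rw [hh2, hu]
    ring
  · rw [hh2, add_sub_cancel]
    gcongr
  · rw [hh2, add_sub_cancel]
    exact pow_lt_one₀ hr0.le (by linarith) two_ne_zero
  · exact mul_lt_one_of_nonneg_of_lt_one_left hs0.le (by linarith) hC1.le

end Constraints

theorem rotatedPlacement_A_eq {n : ℕ} {η : ℝ} (b c : ℂ) (hn : 1 < n) (hη : n * η = 2 * π)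
    (i : Fin n) : rotatedPlacement n η b c (.A i) =
      rotatedPlacement n η b c (.A (prev i)) * Complex.exp (η * Complex.I) := by
  have hv := val_prev i
  simp only [rotatedPlacement]
  rw [← Complex.exp_add, Complex.exp_eq_exp_iff_exists_int]
  split_ifs at hv with hi
  · refine ⟨-1, ?_⟩
    have hη' : (n : ℂ) * η = 2 * π := by exact_mod_cast hη
    rw [hv, hi, Nat.cast_sub hn.le]
    push_cast
    linear_combination -Complex.I * hη'
  · refine ⟨0, ?_⟩
    rw [hv, Nat.cast_sub (by omega)]
    push_cast
    ring

theorem exists_lockedStart {n : ℕ} {l₁ l₂ : ℝ} (hc : Constraints n l₁ l₂) :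
    ∃ p : Joint n → ℂ, (petalLinkage n l₁ l₂ hc.l₁_pos hc.l₂_pos).IsConfiguration p ∧
      IsLockedStart l₁ p := by
  have hn : 1 < n := by have := hc.n_gt; omega
  have hl₁ := hc.l₁_pos
  have hl₂ := hc.l₂_pos
  have hθ := hc.thetaBar_pos
  have hθβ := hc.thetaBar_lt
  have hβ := hc.beta_lt
  have hθn := hc.mul_thetaBar
  have hS : 0 < sin (thetaBar n) := sin_pos_of_pos_of_lt_pi hθ (by linarith [pi_pos])
  have hC : 0 < cos (thetaBar n) := cos_pos_of_mem_Ioo ⟨by linarith [pi_pos], by linarith⟩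
  have hCS := sin_sq_add_cos_sq (thetaBar n)
  obtain ⟨u, h, s, hu0, hh0, hu1, hhu, hAB, hBl, hB1, hs, hsC, hs0, hus, hsC1⟩ := hc.exists_petal
  have hη : ((n : ℝ) - 1) * thetaBar n < 2 * π := by linarith
  set C := cos (thetaBar n) with hCdef
  set S := sin (thetaBar n) with hSdef
  set b : ℂ := ⟨u, -h⟩ with hb
  have hbn : ‖b‖ ^ 2 = u ^ 2 + h ^ 2 := by
    rw [Complex.sq_norm, Complex.normSq_apply, hb]
    ring
  have hlb : l₂ < ‖b‖ := lt_of_pow_lt_pow_left₀ 2 (norm_nonneg _) (hbn ▸ hBl)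
  -- The joint `C` is put at `τ B`, on the segment `OB` at distance `l₂` from `B`.
  set τ : ℝ := 1 - l₂ / ‖b‖ with hτ
  have hb0 : 0 < ‖b‖ := hl₂.trans hlb
  have hτ1 : τ < 1 := by
    have : 0 < l₂ / ‖b‖ := by positivity
    linarith
  have hτ0 : 0 < τ := sub_pos.2 ((div_lt_one hb0).2 hlb)
  have hang : ∀ i, petalAngle (rotatedPlacement n (thetaBar n) b (τ * b)) i = thetaBar n := by
    intro i
    rw [petalAngle_rotatedPlacement _ _ hn hθ hη]
    split_ifs <;> linarith
  -- The sector is taken just wide enough for the chain: its opening is the angle `AOB`, which is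
  -- less than the spacing `θ̄`.
  have hψ0 : 0 ≤ arctan (h / u) := arctan_nonneg.2 (by positivity)
  have hψ : arctan (h / u) < thetaBar n := by
    rw [← arctan_tan (x := thetaBar n) (by linarith [pi_pos]) (by linarith)]
    refine arctan_strictMono ?_
    rw [tan_eq_sin_div_cos, div_lt_div_iff₀ hu0 hC]
    linarith
  have hsec : h * cos (arctan (h / u)) = u * sin (arctan (h / u)) := by
    have h1 := tan_arctan (h / u)
    rw [tan_eq_sin_div_cos] at h1
    have h2 := (cos_arctan_pos (h / u)).ne'
    field_simp at h1
    linarith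
  set p := rotatedPlacement n (thetaBar n) b (τ * b) with hp
  have hO : p .O = 0 := rfl
  have hA : ∀ i, ‖p (.A i)‖ = 1 := fun i => Complex.norm_exp_ofReal_mul_I _
  have hB : ∀ i, p (.B i) = b * p (.A i) := fun i => rfl
  have hCB : ∀ i, p (.C i) = τ * p (.B i) := fun i => mul_assoc _ _ _
  have hAA : ∀ i, p (.A i) * conj (p (.A i)) = 1 := fun i => by
    rw [Complex.mul_conj, Complex.normSq_eq_norm_sq, hA]
    simp
  have hrot : ∀ i, p (.A i) = p (.A (prev i)) * (C + S * Complex.I) := fun i => by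
    rw [hp, rotatedPlacement_A_eq b _ hn hθn, Complex.exp_mul_I, ← Complex.ofReal_cos,
      ← Complex.ofReal_sin]
  have hrot' : ∀ i, p (.A i) * conj (p (.A (prev i))) = C + S * Complex.I := fun i => by
    rw [hrot]
    linear_combination (C + S * Complex.I) * hAA (prev i)
  have hline : ∀ i (s' : ℝ), dist (p (.A i)) (AffineMap.lineMap (p .O) (p (.A (prev i))) s') ^ 2 =
      s' ^ 2 - 2 * s' * C + 1 := fun i s' => by
    rw [sq_dist_lineMap (by rw [hO, sub_zero, hA]) (by rw [hO, sub_zero, hA]), hO, sub_zero,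
      sub_zero, hrot']
    simp
  have hBA : ∀ i, p (.B i) * conj (p (.A i)) = b := fun i => by
    rw [hB]
    linear_combination b * hAA i
  have hBA' : ∀ i, p (.B i) * conj (p (.A (prev i))) = b * (C + S * Complex.I) := fun i => by
    rw [hB, mul_assoc, hrot']
  refine ⟨p,
    isConfiguration_rotatedPlacement (ψ := arctan (h / u)) hψ0 (arctan_lt_pi_div_two _) hψ
      (by linarith) ?_ ?_ ?_ ?_ ?_ ?_ ?_ ?_,
    isCcwOrdered_rotatedPlacement _ _ hθ hη, fun i => ?_, fun i => ⟨?_, ?_, ?_⟩⟩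
  · rw [dist_comm, dist_eq_norm, ← sq_eq_sq₀ (norm_nonneg _) hl₁.le, Complex.sq_norm,
      Complex.normSq_apply]
    simp [hb]
    linarith
  · rw [dist_eq_norm, ← one_sub_mul, norm_mul, ← Complex.ofReal_one, ← Complex.ofReal_sub,
      Complex.norm_real, Real.norm_of_nonneg (by linarith), hτ, sub_sub_cancel,
      div_mul_cancel₀ _ hb0.ne']
  · exact ⟨hu0.le, by simpa [hb] using hh0.le, by simpa [hb] using hsec.le⟩
  · simp only [sector, mem_ofPred_eq, Complex.re_ofReal_mul, Complex.im_ofReal_mul, hb]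
    refine ⟨by positivity, by nlinarith, ?_⟩
    have : τ * (h * cos (arctan (h / u))) = τ * (u * sin (arctan (h / u))) := by rw [hsec]
    linarith
  · rintro ⟨a, d, ha, hd, had, h'⟩
    have e1 := congrArg Complex.re h'
    simp [hb] at e1
    nlinarith
  · refine Subset.antisymm ?_
      (singleton_subset_iff.2 ⟨left_mem_segment _ _ _, left_mem_segment _ _ _⟩)
    rintro w ⟨⟨x, y, hx, hy, hxy, rfl⟩, ⟨x', y', hx', hy', hxy', h'⟩⟩
    have e1 := congrArg Complex.im h'
    simp [hb] at e1
    have : y' = 0 := by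
      rcases e1 with e1 | e1
      · exact e1
      · exact absurd e1 hh0.ne'
    subst this
    rw [← h', add_zero] at *
    simp [hxy']
  · refine Subset.antisymm ?_
      (singleton_subset_iff.2 ⟨left_mem_segment _ _ _, left_mem_segment _ _ _⟩)
    rintro w ⟨⟨x, y, hx, hy, hxy, rfl⟩, ⟨x', y', hx', hy', hxy', h'⟩⟩
    have e1 := congrArg Complex.im h'
    have e2 := congrArg Complex.re h'
    simp [hb] at e1 e2
    have hy0 : y = 0 := by
      have : y * h = 0 := by linear_combination -h * e2 - u * e1
      exact (mul_eq_zero.1 this).resolve_right hh0.ne'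
    subst hy0
    rw [add_zero] at hxy
    simp [hxy]
  · refine Set.disjoint_left.2 ?_
    rintro w ⟨x, y, hx, hy, hxy, rfl⟩ ⟨x', y', hx', hy', hxy', h'⟩
    have e1 := congrArg Complex.im h'
    simp [hb] at e1
    have : 0 < (x' + y' * τ) * h := by
      refine mul_pos ?_ hh0
      rcases hx'.lt_or_eq with hlt | heq
      · positivity
      · have : y' = 1 := by linarith
        rw [← heq, this]
        linarith
    linarith
  · rw [hang]
    exact ⟨hc.alpha_lt_thetaBar, hθβ⟩
  · rw [hang]
    exact hθβ
  · have h1 : 0 < s * S := mul_pos hs0 hS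
    have hh1 : h < s * S := by
      refine lt_of_pow_lt_pow_left₀ 2 h1.le ?_
      have h2 : (1 - s * C) ^ 2 < (1 - u) ^ 2 := by
        have : 0 < 1 - s * C := by linarith
        gcongr
      have h3 : (1 - s * C) ^ 2 + (s * S) ^ 2 = l₁ ^ 2 := by
        rw [← hs]
        linear_combination s ^ 2 * hCS
      linarith
    have hx1 : h / (s * S) < 1 := (div_lt_one h1).2 hh1
    -- In the frame of `A`, `AQ` is real, so the imaginary part of `AB` determines the coefficient
    -- of `AP`, namely `h / (s S)`; the real part then determines that of `AQ`.
    refine ⟨_, ((1 - l₁ : ℝ) : ℂ) * p (.A i), ⟨s, rfl, (sq_eq_sq₀ dist_nonneg hl₁.le).1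
        ((hline i s).trans hs), fun s' hs' => ?_⟩,
      ⟨l₁, 1 - l₁, hl₁.le, by linarith [hc.l₁_lt], by ring, by rw [hO]; simp⟩, ?_, ?_,
      h / (s * S), (1 - u - h / (s * S) * (1 - s * C)) / l₁, by positivity, ?_, ?_⟩
    · have h1 := hline i s'
      rw [hs', ← hs] at h1
      by_contra! hlt
      have h2 : (s - s') * (s + s' - 2 * C) = 0 := by linear_combination h1
      rcases mul_eq_zero.1 h2 with h3 | h3 <;> linarith
    · rw [dist_eq_norm, ← one_sub_mul, norm_mul, hA, mul_one, ← Complex.ofReal_one,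
        ← Complex.ofReal_sub, Complex.norm_real, sub_sub_cancel, Real.norm_of_nonneg hl₁.le]
    · rw [dist_eq_norm, hB, ← sub_one_mul, norm_mul, hA, mul_one, ← sq_eq_sq₀ (norm_nonneg _)
        hl₁.le, Complex.sq_norm, Complex.normSq_apply]
      simp [hb]
      linarith
    · refine div_pos ?_ hl₁
      have : h / (s * S) * (1 - s * C) < 1 * (1 - s * C) :=
        mul_lt_mul_of_pos_right hx1 (by linarith)
      linarith
    · have hb' : b = u - h * Complex.I := by
        apply Complex.ext <;> simp [hb]
      have hS0 : (S : ℂ) ≠ 0 := Complex.ofReal_ne_zero.2 hS.ne'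
      have hs0' : (s : ℂ) ≠ 0 := Complex.ofReal_ne_zero.2 hs0.ne'
      have hl0 : (l₁ : ℂ) ≠ 0 := Complex.ofReal_ne_zero.2 hl₁.ne'
      have hCS' : (S : ℂ) ^ 2 + (C : ℂ) ^ 2 = 1 := by exact_mod_cast hCS
      have hrot'' : p (.A (prev i)) = p (.A i) * (C - S * Complex.I) := by
        rw [hrot i]
        linear_combination -p (.A (prev i)) * hCS' + p (.A (prev i)) * S ^ 2 * Complex.I_sq
      rw [hB, AffineMap.lineMap_apply_module', hO, hrot'', hb']
      simp only [Complex.real_smul, sub_zero, add_zero]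
      push_cast
      field_simp
      ring
  · have e1 : (b * (C + S * Complex.I)).re = u * C + h * S := by simp [hb]
    have e2 : (b * (C + S * Complex.I)).im = u * S - h * C := by simp [hb]; ring
    have e3 : (u * C + h * S) ^ 2 ≤ 1 ^ 2 := by
      have : (u * C + h * S) ^ 2 + (u * S - h * C) ^ 2 = u ^ 2 + h ^ 2 := by
        linear_combination (u ^ 2 + h ^ 2) * hCS
      linarith [sq_nonneg (u * S - h * C)]
    have hR := isFoot_zero (B := p (.B i)) (hA (prev i)) (by rw [hBA', e1]; positivity)
      (by rw [hBA', e1]; exact le_of_sq_le_sq e3 zero_le_one)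
    have hS' := isFoot_zero (B := p (.B i)) (hA i) (by rw [hBA]; exact hu0.le)
      (by rw [hBA]; exact hu1.le)
    refine ⟨_, _, hR, hS', ?_⟩
    rw [hCB, hO]
    refine mul_mem_interior_quadrilateral (hA i) (hA (prev i)) ?_ ?_ ?_ ?_ hτ0 hτ1
    · rw [hBA]
      exact hu0
    · rw [hBA]
      exact neg_neg_of_pos hh0
    · rw [hBA', e1]
      positivity
    · rw [hBA', e2]
      linarith

/-! ### Admissible parameters -/

/-- At the excluded endpoint `l₂ = l_P(θ̄)` the angle `θ_m` equals `θ̄`, which exceeds `α`. By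
continuity `l₂` slightly smaller satisfies all constraints. With `n = 8` and `l₁² = 51/100` the root
in `l_P(π/4)` is exactly `1/10`. -/
theorem exists_constraints : ∃ (n : ℕ) (l₁ l₂ : ℝ), Constraints n l₁ l₂ := by
  have hθ : thetaBar 8 = π / 4 := by
    unfold thetaBar
    push_cast
    ring
  have h2 : √2 ^ 2 = (2 : ℝ) := Real.sq_sqrt zero_le_two
  have h20 : 0 ≤ √(2 : ℝ) := Real.sqrt_nonneg _
  have h2l : 1.41 < √(2 : ℝ) := Real.lt_sqrt_of_sq_lt (by norm_num)
  have h2u : √(2 : ℝ) < 1.42 := (Real.sqrt_lt' (by norm_num)).2 (by norm_num)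
  set l : ℝ := √(51 / 100) with hl
  have hl2 : l ^ 2 = 51 / 100 := Real.sq_sqrt (by norm_num)
  have hl0 : 0 < l := Real.sqrt_pos.2 (by norm_num)
  have hl1 : l < 1 := by nlinarith
  have hl7 : √2 / 2 < l := lt_of_pow_lt_pow_left₀ 2 hl0.le (by rw [div_pow, h2, hl2]; norm_num)
  have hlP : lP l (π / 4) = √2 / 2 - 1 / 10 := by
    unfold lP
    rw [cos_pi_div_four, sin_pi_div_four, hl2, div_pow, h2]
    congr 1
    rw [Real.sqrt_eq_iff_mul_self_eq] <;> norm_num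
  have hβ : π / 4 < beta l := by
    unfold beta
    rw [← arcsin_sin (x := π / 4) (by linarith [pi_pos]) (by linarith [pi_pos]), sin_pi_div_four]
    exact arcsin_lt_arcsin (by linarith) hl7 hl1.le
  have hβ' : beta l < π / 2 := arcsin_lt_pi_div_two.2 hl1
  have hα : alpha 8 l < π / 4 := by
    unfold alpha
    rw [div_lt_iff₀ (by norm_num)]
    push_cast
    linarith
  have hα0 : 0 < alpha 8 l := by
    refine div_pos ?_ (by norm_num)
    linarith [pi_pos]
  have hcos : √2 / 2 < cos (alpha 8 l) := by
    rw [← cos_pi_div_four]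
    exact cos_lt_cos_of_nonneg_of_le_pi_div_two hα0.le (by linarith [pi_pos]) hα
  set L : ℝ := √2 / 2 - 1 / 10 with hL
  -- The bound `3/5` exceeds `1/2 ≥ sin β cos β`, and together with `l > 0.7` it gives `l₁ + l₂ >
  -- 1`.
  have hL0 : 3 / 5 < L := by linarith
  have hcont : ContinuousAt (fun x : ℝ => (1 - l ^ 2 + x ^ 2) / (2 * x)) L := by
    have : 2 * L ≠ 0 := by linarith
    fun_prop (disch := assumption)
  have hval : (1 - l ^ 2 + L ^ 2) / (2 * L) = √2 / 2 := by
    rw [div_eq_iff (by linarith), hl2, hL]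
    linear_combination (-1 / 4) * h2
  have hev := hcont.eventually_lt_const (hval.trans_lt hcos)
  have hev' : ∀ᶠ x in nhdsWithin L (Iio L), 3 / 5 < x ∧ x < L ∧
      (1 - l ^ 2 + x ^ 2) / (2 * x) < cos (alpha 8 l) := by
    filter_upwards [(hev.filter_mono nhdsWithin_le_nhds),
      (nhdsWithin_le_nhds (Ioi_mem_nhds hL0)), self_mem_nhdsWithin] with x h1 h2 h3
    exact ⟨h2, h3, h1⟩
  obtain ⟨x, hx1, hx2, hx3⟩ := hev'.exists
  refine ⟨8, l, x, ⟨by norm_num, hl0, by linarith, hl1, by rw [hθ]; exact hβ,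
    by rw [hθ, hlP]; exact hx2, ?_, by linarith, ?_⟩⟩
  · unfold beta
    rw [sin_arcsin (by linarith) hl1.le, cos_arcsin]
    have h3 : √(1 - l ^ 2) ^ 2 = 49 / 100 := by
      rw [Real.sq_sqrt (by rw [hl2]; norm_num), hl2]
      norm_num
    nlinarith [sq_nonneg (l - √(1 - l ^ 2))]
  · unfold thetaMin
    rw [← arccos_cos hα0.le (by linarith [pi_pos])]
    refine arccos_lt_arccos ?_ hx3 (cos_le_one _)
    have : 0 ≤ (1 - l ^ 2 + x ^ 2) / (2 * x) := by
      rw [hl2]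
      have : 0 < x := by linarith
      have : (0 : ℝ) ≤ 1 - 51 / 100 := by norm_num
      positivity
    linarith

end PetalTree

theorem theorem5 :
    (∀ (n : ℕ) (l₁ l₂ : ℝ) (hc : Constraints n l₁ l₂),
      (∀ γ : unitInterval → Joint n → ℂ,
        (petalLinkage n l₁ l₂ hc.l₁_pos hc.l₂_pos).IsMotion γ → IsLockedStart l₁ (γ 0) →
          ∀ (t : unitInterval) (i : Fin n),
            petalAngle (γ t) i ∈ Ioo (alpha n l₁) (beta l₁)) ∧
      (∀ p q : Joint n → ℂ, IsLockedStart l₁ p → (∃ i, petalAngle q i < alpha n l₁) →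
        ¬ (petalLinkage n l₁ l₂ hc.l₁_pos hc.l₂_pos).Equivalent p q) ∧
      (petalLinkage n l₁ l₂ hc.l₁_pos hc.l₂_pos).graph.IsTree ∧
      (∃ p q : Joint n → ℂ,
        (petalLinkage n l₁ l₂ hc.l₁_pos hc.l₂_pos).IsConfiguration p ∧
        (petalLinkage n l₁ l₂ hc.l₁_pos hc.l₂_pos).IsConfiguration q ∧
        IsLockedStart l₁ p ∧ IsCcwOrdered q ∧ ∃ i, petalAngle q i < alpha n l₁)) ∧
    (∃ (n : ℕ) (l₁ l₂ : ℝ), Constraints n l₁ l₂) := by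
  refine ⟨fun n l₁ l₂ hc => ?_, exists_constraints⟩
  have hmotion : ∀ γ : unitInterval → Joint n → ℂ,
      (petalLinkage n l₁ l₂ hc.l₁_pos hc.l₂_pos).IsMotion γ → IsLockedStart l₁ (γ 0) →
        ∀ (t : unitInterval) (i : Fin n), petalAngle (γ t) i ∈ Ioo (alpha n l₁) (beta l₁) :=
    fun γ hγ h0 => hγ.petalAngle_mem hc (h0.isTrapped hc (hγ.isConfiguration 0))
  refine ⟨hmotion, ?_, petalLinkage_isTree, ?_⟩
  · rintro p q hp ⟨i, hi⟩ ⟨γ, hγ, rfl, rfl⟩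
    exact (hmotion γ hγ hp 1 i).1.not_gt hi
  · obtain ⟨p, hp, hs⟩ := exists_lockedStart hc
    obtain ⟨q, hq, ho, hi⟩ := exists_radial_configuration hc
    exact ⟨p, q, hp, hq, hs, ho, hi⟩
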